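/- Let $\mathfrak g$ be a split real form of a complex simple Lie algebra of type $A_3$, $B_2$, $G_2$ or $D_l$ with $l\ge 5$, with Iwasawa decomposition $\mathfrak g=\mathfrak k\oplus\mathfrak a\oplus\mathfrak n$, roots $\Pi$ of $(\mathfrak g,\mathfrak a)$, negative roots $\Pi^-$ for a choice of simple roots, and root spaces $\mathfrak g_\alpha$. Let $K$ be the group of automorphisms of $\mathfrak g$ generated by $\exp(\mathrm{ad}\,Z)$, $Z\in\mathfrak k$, let $M$ be the centralizer of $\mathfrak a$ in $K$, and let $\mathbb F=K/M$ be the maximal real flag manifold, whose tangent space at the origin is identified with $\mathfrak n^-=\sum_{\alpha\in\Pi^-}\mathfrak g_\alpha$, with isotropy representation $\mathrm{Ad}$. Two roots $\alpha,\beta$ are $M$-equivalent, $\alpha\sim_M\beta$, if the representations of $M$ on $\mathfrak g_\alpha$ and $\mathfrak g_\beta$ are equivalent; $[\alpha]_M$ denotes the $M$-equivalence class of $\alpha$ in $\Pi^-$. Fix a Weyl basis $(X_\alpha)_{\alpha\in\Pi}$: $X_\alpha\in\mathfrak g_\alpha$, $\langle X_\alpha,X_{-\alpha}\rangle=1$ for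 the Killing form, $[X_\alpha,X_\beta]=m_{\alpha,\beta}X_{\alpha+\beta}$ whenever $\alpha+\beta$ is a root, with $m_{-\alpha,-\beta}=-m_{\alpha,\beta}$, and $m_{\alpha,\beta}=0$ if $\alpha+\beta$ is not a root. For $\alpha\in\Pi^-$ put $X_\alpha^*=\langle X_{-\alpha},\cdot\rangle\in(\mathfrak n^-)^*$. Let $\mathbb J,\mathbb J'$ be $K$-invariant generalized almost complex structures on $\mathbb F$, that is, $K$-invariant endomorphisms of $T\mathbb F\oplus T^*\mathbb F$ with square $-1$, orthogonal for $\langle X+\xi,Y+\eta\rangle=\tfrac12(\xi(Y)+\eta(X))$. The pair $(\mathbb J,\mathbb J')$ is called generalized almost Hermitian if $\mathbb J\mathbb J'=\mathbb J'\mathbb J$ and $G=-\mathbb J\mathbb J'$ is positive definite, i.e. $\langle \mathbb Jv,\mathbb J'v\rangle>0$ for all $v\ne0$. For real $b$ and $c\ne 0$, and for real $a,x,y$ with $a^2=xy-1$, put $$\mathcal J^{c}=\begin{pmatrix} b&-\frac{1+b^2}{c}&0&0\\ c&-b&0&0\\ 0&0&-b&-c\\ 0&0&\frac{1+b^2}{c}&b\end{pmatrix}\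 \text{(complex type)},\qquad \mathcal J^{nc}=\begin{pmatrix} a&0&0&-x\\ 0&a&x&0\\ 0&-y&-a&0\\ y&0&0&-a\end{pmatrix}\ \text{(noncomplex type)}.$$ A matrix $\mathcal J^{c}$ is denoted $(\mathcal J^c)^+$ if $c>0$ and $(\mathcal J^c)^-$ if $c<0$; a matrix $\mathcal J^{nc}$ is denoted $(\mathcal J^{nc})^+$ if $x>0$ and $(\mathcal J^{nc})^-$ if $x<0$. Then $(\mathbb J,\mathbb J')$ is generalized almost Hermitian if and only if every $M$-equivalence class in $\Pi^-$ has exactly two elements and, for every $\alpha\in\Pi^-$, with $[\alpha]_M=\{\alpha,\beta\}$, $\beta\neq\alpha$, and $V_{[\alpha]_M}=\mathfrak g_\alpha\oplus\mathfrak g_\beta$, both structures at the origin preserve $V_{[\alpha]_M}\oplus V_{[\alpha]_M}^*$ and the matrices $(\mathbb J_{[\alpha]_M},\mathbb J'_{[\alpha]_M})$ of their restrictions in the basis $(X_\alpha,X_\beta,X_\alpha^*,X_\beta^*)$ form a pair of one of the four kinds (the parameters of the two entries being independent apart from the signs) $$\big((\mathcal J^{c})^+,(\mathcal J'^{\,nc})^+\big),\quad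 \big((\mathcal J^{nc})^+,(\mathcal J'^{\,c})^+\big),\quad \big((\mathcal J^{c})^-,(\mathcal J'^{\,nc})^-\big),\quad \big((\mathcal J^{nc})^-,(\mathcal J'^{\,c})^-\big).$$ -/

import Mathlib

open LieAlgebra

namespace RealFlag

noncomputable section

/-! ### Split real semisimple Lie algebras and their root systems

Throughout, `𝔤` is a finite-dimensional real Lie algebra with non-degenerate Killing form and `A` is
a splitting Cartan subalgebra (all `ad H`, `H ∈ A`, are diagonalizable over `ℝ`), so that `𝔤` is a
split real form and `A` plays the role of `𝔞` in an Iwasawa decomposition `𝔤 = 𝔨 ⊕ 𝔞 ⊕ 𝔫`. -/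

section Lie

variable {𝔤 : Type*} [LieRing 𝔤] [LieAlgebra ℝ 𝔤] [FiniteDimensional ℝ 𝔤]
  [LieAlgebra.IsKilling ℝ 𝔤]
variable (A : LieSubalgebra ℝ 𝔤) [A.IsCartanSubalgebra] [LieModule.IsTriangularizable ℝ A 𝔤]

/-- The set of roots of `(𝔤, 𝔞)`, as linear functionals on `𝔞`. -/
def rootFunctionals : Set (Module.Dual ℝ A) :=
  Set.range (LieAlgebra.IsKilling.rootSystem A).root

/-- Type `A₃`: the roots are `λᵢ - λⱼ`, `i ≠ j`, for functionals `λ₁, …, λ₄` whose consecutive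
differences are linearly independent. -/
def IsTypeA3 : Prop :=
  ∃ l : Fin 4 → Module.Dual ℝ A,
    LinearIndependent ℝ (fun i : Fin 3 => l i.castSucc - l i.succ) ∧
    rootFunctionals A = {φ | ∃ i j, i ≠ j ∧ φ = l i - l j}

/-- Type `B₂`: the roots are `±λ₁ ± λ₂`, `±λ₁`, `±λ₂` for a basis `λ₁, λ₂` of `𝔞*`. -/
def IsTypeB2 : Prop :=
  ∃ l : Module.Basis (Fin 2) ℝ (Module.Dual ℝ A),
    rootFunctionals A =
      {φ | (∃ s t : ℤˣ, φ = s • l 0 + t • l 1) ∨ ∃ (s : ℤˣ) (i : Fin 2), φ = s • l i}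

/-- Type `D_n`: the roots are `±λᵢ ± λⱼ`, `i < j`, for a basis `λ₁, …, λₙ` of `𝔞*`. -/
def IsTypeD (n : ℕ) : Prop :=
  ∃ l : Module.Basis (Fin n) ℝ (Module.Dual ℝ A),
    rootFunctionals A = {φ | ∃ (i j : Fin n) (s t : ℤˣ), i < j ∧ φ = s • l i + t • l j}

/-- Type `G₂`: for a basis `λ₁, λ₂` of `𝔞*` the roots are `±λ₁`, `±λ₂`, `±(λ₁ + λ₂)`,
`±(λ₁ + 2λ₂)`, `±(λ₁ + 3λ₂)`, `±(2λ₁ + 3λ₂)`. -/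
def IsTypeG2 : Prop :=
  ∃ l : Module.Basis (Fin 2) ℝ (Module.Dual ℝ A),
    rootFunctionals A =
      {φ | ∃ (s : ℤˣ) (p : ℤ × ℤ),
        p ∈ ({(1, 0), (0, 1), (1, 1), (1, 2), (1, 3), (2, 3)} : Set (ℤ × ℤ)) ∧
        φ = s • (p.1 • l 0 + p.2 • l 1)}

/-- The types `A₃`, `B₂`, `G₂` and `D_n` with `n ≥ 5`. -/
def IsSpecialType : Prop :=
  IsTypeA3 A ∨ IsTypeB2 A ∨ IsTypeG2 A ∨ ∃ n, 5 ≤ n ∧ IsTypeD A n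

/-- The opposite of a root. -/
def negRoot (α : A.root) : A.root := ⟨-α.1, by obtain ⟨a, h⟩ := α; simpa using h⟩

/-- A Weyl basis: root vectors `X_α` with `⟨X_α, X_{-α}⟩ = 1` for the Killing form and
`[X_α, X_β] = m_{α,β} X_{α+β}`, where `m_{-α,-β} = -m_{α,β}` and `m_{α,β} = 0` if `α + β` is not a
root. -/
structure WeylBasis where
  X : A.root → 𝔤
  mem (α : A.root) : X α ∈ rootSpace A α.1
  killing (α : A.root) : killingForm ℝ 𝔤 (X α) (X (negRoot A α)) = 1
  m : A.root → A.root → ℝ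
  lie (α β γ : A.root) (h : (γ.1 : A → ℝ) = α.1 + β.1) : ⁅X α, X β⁆ = m α β • X γ
  m_neg (α β : A.root) : m (negRoot A α) (negRoot A β) = -m α β
  m_zero (α β : A.root) (h : ∀ γ : A.root, (γ.1 : A → ℝ) ≠ α.1 + β.1) : m α β = 0

variable {A}

/-- The negative roots `Π⁻` for the choice of positive roots given by the simple roots `B`. -/
abbrev NegRoot (B : (LieAlgebra.IsKilling.rootSystem A).Base) : Type _ :=
  {α : A.root // ¬ B.IsPos α}

/-- `𝔫⁻ = ∑_{α ∈ Π⁻} 𝔤_α`. -/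
def nMinus (B : (LieAlgebra.IsKilling.rootSystem A).Base) : Submodule ℝ 𝔤 :=
  ⨆ α : NegRoot B, (rootSpace A α.1.1).toSubmodule

variable (A)

/-- `θ` is a Cartan involution of `𝔤` (an involutive automorphism for which `-⟨x, θ y⟩` is positive
definite) with `𝔞` in its `-1`-eigenspace. -/
structure IsCartanInvolution (θ : 𝔤 →ₗ⁅ℝ⁆ 𝔤) : Prop where
  involutive (x : 𝔤) : θ (θ x) = x
  neg_of_ne_zero (x : 𝔤) (hx : x ≠ 0) : killingForm ℝ 𝔤 x (θ x) < 0
  apply_cartan (H : A) : θ H = -H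

end Lie

/-- The exponential of an endomorphism of a finite-dimensional real vector space. -/
def expEnd {V : Type*} [AddCommGroup V] [Module ℝ V] [FiniteDimensional ℝ V]
    (T : Module.End ℝ V) : Module.End ℝ V :=
  Matrix.toLin (Module.finBasis ℝ V) (Module.finBasis ℝ V)
    (NormedSpace.exp (LinearMap.toMatrix (Module.finBasis ℝ V) (Module.finBasis ℝ V) T))

/-! ### The groups `K` and `M`, and the isotropy representation -/

section Groups

variable {𝔤 : Type*} [LieRing 𝔤] [LieAlgebra ℝ 𝔤] [FiniteDimensional ℝ 𝔤]

/-- The maximal compact subgroup `K` of the group of inner automorphisms of `𝔤`: the subgroup of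
`GL(𝔤)` generated by the automorphisms `exp (ad Z)` with `Z ∈ 𝔨 = {Z | θ Z = Z}`. (All `exp (ad Z)`
are Lie algebra automorphisms, so the second condition only records this.) -/
def groupK (θ : 𝔤 →ₗ⁅ℝ⁆ 𝔤) : Subgroup (𝔤 ≃ₗ[ℝ] 𝔤) :=
  Subgroup.closure {φ | (∃ Z : 𝔤, θ Z = Z ∧ (φ : 𝔤 →ₗ[ℝ] 𝔤) = expEnd (LieAlgebra.ad ℝ 𝔤 Z)) ∧
    ∀ x y : 𝔤, φ ⁅x, y⁆ = ⁅φ x, φ y⁆}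

lemma groupK_lie (θ : 𝔤 →ₗ⁅ℝ⁆ 𝔤) {k : 𝔤 ≃ₗ[ℝ] 𝔤} (hk : k ∈ groupK θ) (x y : 𝔤) :
    k ⁅x, y⁆ = ⁅k x, k y⁆ := by
  induction hk using Subgroup.closure_induction generalizing x y with
  | mem φ h => exact h.2 x y
  | one => rfl
  | mul a b _ _ ha hb => rw [LinearEquiv.mul_apply, hb, ha]; rfl
  | inv a _ ha =>
    apply a.injective
    rw [ha, ← LinearEquiv.mul_apply, ← LinearEquiv.mul_apply, ← LinearEquiv.mul_apply]
    simp

variable [LieAlgebra.IsKilling ℝ 𝔤]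
variable (A : LieSubalgebra ℝ 𝔤) [A.IsCartanSubalgebra] [LieModule.IsTriangularizable ℝ A 𝔤]

/-- `M`, the centralizer of `𝔞` in `K`. -/
def groupM (θ : 𝔤 →ₗ⁅ℝ⁆ 𝔤) : Subgroup (groupK θ) where
  carrier := {k | ∀ H : A, (k : 𝔤 ≃ₗ[ℝ] 𝔤) H = H}
  one_mem' _ := rfl
  mul_mem' {a b} ha hb H := by
    have h1 := ha H
    have h2 := hb H
    simp only [Subgroup.coe_mul, LinearEquiv.mul_apply, h2, h1]
  inv_mem' {a} ha H := by
    apply (a : 𝔤 ≃ₗ[ℝ] 𝔤).injective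
    rw [ha H, ← LinearEquiv.mul_apply]
    simp

/-- The adjoint representation of `M` on `𝔤`. -/
def adRep (θ : 𝔤 →ₗ⁅ℝ⁆ 𝔤) : Representation ℝ (groupM A θ) 𝔤 where
  toFun m := (((m : groupK θ) : 𝔤 ≃ₗ[ℝ] 𝔤) : 𝔤 →ₗ[ℝ] 𝔤)
  map_one' := rfl
  map_mul' _ _ := rfl

lemma adRep_mem_rootSpace (θ : 𝔤 →ₗ⁅ℝ⁆ 𝔤) (α : A → ℝ) (m : groupM A θ) {x : 𝔤}
    (hx : x ∈ rootSpace A α) : adRep A θ m x ∈ rootSpace A α := by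
  apply LieModule.weightSpace_le_genWeightSpace
  rw [LieModule.mem_weightSpace]
  intro H
  have h1 : ⁅(H : 𝔤), x⁆ = α H • x := LieAlgebra.IsKilling.lie_eq_smul_of_mem_rootSpace hx H
  have h2 := groupK_lie θ (m : groupK θ).2 (H : 𝔤) x
  have h3 : ((m : groupK θ) : 𝔤 ≃ₗ[ℝ] 𝔤) (H : 𝔤) = H := m.2 H
  rw [h3, h1, map_smul] at h2
  exact h2.symm

/-- The representation of `M` on the root space `𝔤_α`. -/
def rootRep (θ : 𝔤 →ₗ⁅ℝ⁆ 𝔤) (α : A.root) :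
    Representation ℝ (groupM A θ) (rootSpace A α.1).toSubmodule :=
  (adRep A θ).subrepresentation _ fun m _ hx => adRep_mem_rootSpace A θ α.1 m hx

/-- `M`-equivalence of roots: the representations of `M` on the two root spaces are equivalent. -/
def MEquiv (θ : 𝔤 →ₗ⁅ℝ⁆ 𝔤) (α β : A.root) : Prop :=
  Nonempty ((rootRep A θ α).Equiv (rootRep A θ β))

variable {A}

/-- The isotropy representation: the adjoint representation of `M` on `𝔫⁻ = T_{b₀}𝔽`. -/
def isotropyRep (θ : 𝔤 →ₗ⁅ℝ⁆ 𝔤) (B : (LieAlgebra.IsKilling.rootSystem A).Base) :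
    Representation ℝ (groupM A θ) (nMinus B) :=
  (adRep A θ).subrepresentation (nMinus B) fun m => iSup_le fun α _ hx =>
    Submodule.mem_iSup_of_mem (p := fun α : NegRoot B => (rootSpace A α.1.1).toSubmodule) α
      (adRep_mem_rootSpace A θ α.1.1 m hx)

/-- The fibre `𝔫⁻ ⊕ (𝔫⁻)*` of the generalized tangent bundle at the origin. -/
abbrev GenTangent (B : (LieAlgebra.IsKilling.rootSystem A).Base) : Type _ :=
  nMinus B × Module.Dual ℝ (nMinus B)

/-- The natural inner product `⟨X + ξ, Y + η⟩ = (ξ(Y) + η(X)) / 2`. -/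
def pairing {B : (LieAlgebra.IsKilling.rootSystem A).Base} (v w : GenTangent B) : ℝ :=
  (v.2 w.1 + w.2 v.1) / 2

/-- The representation `Ad ⊕ Ad*` of `M` on `𝔫⁻ ⊕ (𝔫⁻)*`. -/
def genIsotropyRep (θ : 𝔤 →ₗ⁅ℝ⁆ 𝔤) (B : (LieAlgebra.IsKilling.rootSystem A).Base) :
    Representation ℝ (groupM A θ) (GenTangent B) :=
  (isotropyRep θ B).prod (isotropyRep θ B).dual

/-! ### Invariant generalized almost complex structures on `𝔽 = K / M`

The generalized tangent bundle of `𝔽` is the associated bundle `K ×_M (𝔫⁻ ⊕ (𝔫⁻)*)`, in which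
`[k m, v] = [k, (Ad ⊕ Ad*)(m) v]`. Its bundle endomorphisms are the functions
`J : K → End(𝔫⁻ ⊕ (𝔫⁻)*)` with `J (k m) = (Ad ⊕ Ad*)(m)⁻¹ ∘ J k ∘ (Ad ⊕ Ad*)(m)`, acting by
`[k, v] ↦ [k, J k v]`. The value at the origin `b₀ = 1 · M` is `J 1`. -/

/-- A `K`-invariant generalized almost complex structure on `𝔽 = K / M`. (Invariance makes `J`
constant in this description, hence smooth.) -/
structure InvGenAlmostComplex (θ : 𝔤 →ₗ⁅ℝ⁆ 𝔤)
    (B : (LieAlgebra.IsKilling.rootSystem A).Base) where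
  J : groupK θ → Module.End ℝ (GenTangent B)
  equivariant (k : groupK θ) (m : groupM A θ) :
    J (k * m) = genIsotropyRep θ B m⁻¹ * J k * genIsotropyRep θ B m
  sq (k : groupK θ) : J k * J k = -1
  orthogonal (k : groupK θ) (v w : GenTangent B) : pairing (J k v) (J k w) = pairing v w
  invariant (g k : groupK θ) : J (g * k) = J k

/-- `(J, J')` is a generalized almost Hermitian structure: at every point of `𝔽` the two structures
commute and `G = -J J'` is positive definite, that is, the form
`⟨G v, w⟩ = ⟨J v, J' w⟩` is. -/
def IsGenAlmostHermitian {θ : 𝔤 →ₗ⁅ℝ⁆ 𝔤} {B : (LieAlgebra.IsKilling.rootSystem A).Base}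
    (𝒥 𝒥' : InvGenAlmostComplex θ B) : Prop :=
  (∀ k, 𝒥.J k * 𝒥'.J k = 𝒥'.J k * 𝒥.J k) ∧
  ∀ k (v : GenTangent B), v ≠ 0 → 0 < pairing (𝒥.J k v) (𝒥'.J k v)

/-! ### The restrictions to the `M`-classes -/

/-- For `α ∈ Π⁻`, the vector `X_α` of `𝔫⁻`. -/
def WeylBasis.vec {B : (LieAlgebra.IsKilling.rootSystem A).Base} (W : WeylBasis A)
    (α : NegRoot B) : nMinus B :=
  ⟨W.X α.1, Submodule.mem_iSup_of_mem
    (p := fun α : NegRoot B => (rootSpace A α.1.1).toSubmodule) α (W.mem α.1)⟩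

/-- For `α ∈ Π⁻`, the covector `X_α* = ⟨X_{-α}, ·⟩` on `𝔫⁻`. -/
def WeylBasis.covec {B : (LieAlgebra.IsKilling.rootSystem A).Base} (W : WeylBasis A)
    (α : NegRoot B) : Module.Dual ℝ (nMinus B) :=
  (killingForm ℝ 𝔤 (W.X (negRoot A α.1))) ∘ₗ (nMinus B).subtype

/-- The basis `(X_α, X_β, X_α*, X_β*)` of `V ⊕ V*`, where `V = 𝔤_α ⊕ 𝔤_β`. -/
def WeylBasis.frame {B : (LieAlgebra.IsKilling.rootSystem A).Base} (W : WeylBasis A)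
    (α β : NegRoot B) : Fin 4 → GenTangent B :=
  ![(W.vec α, 0), (W.vec β, 0), (0, W.covec α), (0, W.covec β)]

/-- At the origin, `𝒥` maps `V ⊕ V*` to itself, `V = 𝔤_α ⊕ 𝔤_β`, and its restriction has matrix `P`
with respect to `(X_α, X_β, X_α*, X_β*)` (the columns being the images). -/
def HasRestriction {θ : 𝔤 →ₗ⁅ℝ⁆ 𝔤} {B : (LieAlgebra.IsKilling.rootSystem A).Base}
    (W : WeylBasis A) (𝒥 : InvGenAlmostComplex θ B) (α β : NegRoot B)
    (P : Matrix (Fin 4) (Fin 4) ℝ) : Prop :=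
  ∀ j, 𝒥.J 1 (W.frame α β j) = ∑ i, P i j • W.frame α β i

/-- The matrices of complex type (for `c ≠ 0`). -/
def complexMatrix (b c : ℝ) : Matrix (Fin 4) (Fin 4) ℝ :=
  !![b, -(1 + b ^ 2) / c, 0, 0;
     c, -b, 0, 0;
     0, 0, -b, -c;
     0, 0, (1 + b ^ 2) / c, b]

/-- The matrices of noncomplex type (for `a² = x y - 1`). -/
def noncomplexMatrix (a x y : ℝ) : Matrix (Fin 4) (Fin 4) ℝ :=
  !![a, 0, 0, -x;
     0, a, x, 0;
     0, -y, -a, 0;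
     y, 0, 0, -a]

section Signs

variable {θ : 𝔤 →ₗ⁅ℝ⁆ 𝔤} {B : (LieAlgebra.IsKilling.rootSystem A).Base}
  (W : WeylBasis A) (𝒥 : InvGenAlmostComplex θ B) (α β : NegRoot B)

/-- The restriction is of complex type with sign `+`. -/
def IsComplexPos : Prop :=
  ∃ b c : ℝ, 0 < c ∧ HasRestriction W 𝒥 α β (complexMatrix b c)

/-- The restriction is of complex type with sign `-`. -/
def IsComplexNeg : Prop :=
  ∃ b c : ℝ, c < 0 ∧ HasRestriction W 𝒥 α β (complexMatrix b c)

/-- The restriction is of noncomplex type with sign `+`. -/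
def IsNoncomplexPos : Prop :=
  ∃ a x y : ℝ, a ^ 2 = x * y - 1 ∧ 0 < x ∧ HasRestriction W 𝒥 α β (noncomplexMatrix a x y)

/-- The restriction is of noncomplex type with sign `-`. -/
def IsNoncomplexNeg : Prop :=
  ∃ a x y : ℝ, a ^ 2 = x * y - 1 ∧ x < 0 ∧ HasRestriction W 𝒥 α β (noncomplexMatrix a x y)

end Signs

end Groups

end

end RealFlag

open RealFlag

set_option linter.unusedSectionVars false

/-! Invariance reduces everything to linear algebra at the origin: a structure is a single
endomorphism of 𝔫⁻ ⊕ (𝔫⁻)* commuting with M. Root spaces are lines and M preserves the definite form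
κ(x, θ y), where κ is the Killing form, so M acts on each root space by a sign
(`IsCartanInvolution.exists_sign`), and on the dual line by the same sign. Hence M-equivalence is
equality of sign characters, and entries between inequivalent roots vanish
(`InvGenAlmostComplex.entries_eq_zero`).

To bound the classes one needs enough elements of M. For a long root γ with adapted triple e, h, f,
the half turn exp(π ad(e - f)) lies in M and acts on 𝔤_α by (-1)^⟨α, γ^∨⟩
(`expEnd_apply_of_isLong`). In the listed types the parities of these Cartan integers separate roots
up to sign, except for pairs (`IsSpecialType.separatesRoots`), so a class has at most two negative
roots. It cannot have only one, since a generalized complex structure does not preserve a line plus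
its dual (`IsGenComplex.not_preserves_line`).

On a plane plus its dual, skewness and J² = -1 leave exactly the complex and noncomplex types
(`IsGenComplex.complex_or_noncomplex`). If J and J' have the same type, J X_α and J' X_α are
orthogonal, against positivity; if the types differ, their pairing is a positive multiple of c y,
and x y = 1 + a² turns c y > 0 into c x > 0. Conversely, blocks of opposite types commute, and c x
times the Hermitian form of a block is a sum of four squares (`hermitian_form_pos`), so blocks of
equal signs assemble to a positive definite G (`IsGenComplex.hermitian_of_blocks`). -/

namespace RealFlag

open LieModule LieAlgebra.IsKilling

/-! ### Exponentials of operators acting as rotations -/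

section Exponential

lemma hasSum_exp_matrix {n : ℕ} (M : Matrix (Fin n) (Fin n) ℝ) :
    HasSum (fun j : ℕ => (j.factorial⁻¹ : ℝ) • M ^ j) (NormedSpace.exp M) := by
  let _ : NormedRing (Matrix (Fin n) (Fin n) ℝ) := Matrix.linftyOpNormedRing
  let _ : NormedAlgebra ℝ (Matrix (Fin n) (Fin n) ℝ) := Matrix.linftyOpNormedAlgebra
  exact NormedSpace.exp_series_hasSum_exp' (𝕂 := ℝ) M

/-- On a plane on which `M` acts as `k` times a quarter turn, its exponential is a rotation. -/
lemma exp_mulVec_of_rotation {n : ℕ} (M : Matrix (Fin n) (Fin n) ℝ) (v w : Fin n → ℝ) {k : ℝ}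
    (hv : M.mulVec v = k • w) (hw : M.mulVec w = -k • v) :
    (NormedSpace.exp M).mulVec v = Real.cos k • v + Real.sin k • w := by
  -- Parametrize the span of `v`, `w` by ℂ, with 1 ↦ v and i ↦ w. Then `M` becomes multiplication by
  -- ik and its exponential multiplication by exp(ik). Independence of `v` and `w` is not needed.
  let f : ℂ →ₗ[ℝ] (Fin n → ℝ) := Complex.reLm.smulRight v + Complex.imLm.smulRight w
  have hf : ∀ z, f z = z.re • v + z.im • w := fun z => rfl
  have hstep : ∀ z : ℂ, M.mulVec (f z) = f ((Complex.I * k) * z) := by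
    intro z
    rw [hf, hf, Matrix.mulVec_add, Matrix.mulVec_smul, Matrix.mulVec_smul, hv, hw]
    simp only [Complex.mul_re, Complex.mul_im, Complex.I_re, Complex.I_im, Complex.ofReal_re,
      Complex.ofReal_im, smul_smul]
    rw [add_comm]
    congr 2 <;> ring
  have hpow : ∀ j : ℕ, (M ^ j).mulVec v = f ((Complex.I * k) ^ j) := by
    intro j
    induction j with
    | zero => simp [hf]
    | succ j ih => rw [pow_succ', ← Matrix.mulVec_mulVec, ih, hstep, pow_succ']
  have h2 := NormedSpace.exp_series_hasSum_exp' (𝕂 := ℝ) (Complex.I * k)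
  let g : Matrix (Fin n) (Fin n) ℝ →ₗ[ℝ] (Fin n → ℝ) := (Matrix.mulVecBilin ℝ ℝ).flip v
  have hg : ∀ M, g M = M.mulVec v := fun _ => rfl
  have hcont : Continuous g := by
    change Continuous fun M : Matrix (Fin n) (Fin n) ℝ => M.mulVec v
    fun_prop
  have h3 := (hasSum_exp_matrix M).map g hcont
  have h4 := h2.mapL f.toContinuousLinearMap
  have h5 : (g ∘ fun j : ℕ => (j.factorial⁻¹ : ℝ) • M ^ j) =
      fun j : ℕ => f.toContinuousLinearMap ((j.factorial⁻¹ : ℝ) • (Complex.I * k) ^ j) := by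
    funext j
    rw [Function.comp_apply, g.map_smul, hg, hpow]
    exact (f.map_smul _ _).symm
  rw [h5] at h3
  have h6 := h3.unique h4
  simp only [LinearMap.coe_toContinuousLinearMap', hg] at h6
  rw [h6, hf, ← Complex.exp_eq_exp_ℂ, mul_comm, Complex.exp_ofReal_mul_I_re,
    Complex.exp_ofReal_mul_I_im]

end Exponential

section ExpEnd

variable {V : Type*} [AddCommGroup V] [Module ℝ V] [FiniteDimensional ℝ V]

lemma expEnd_apply_of_rotation {T : Module.End ℝ V} {x y : V} {k : ℝ}
    (hx : T x = k • y) (hy : T y = -k • x) :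
    expEnd T x = Real.cos k • x + Real.sin k • y := by
  set b := Module.finBasis ℝ V
  have hT : ∀ z, (LinearMap.toMatrix b b T).mulVec (b.repr z) = b.repr (T z) := fun z =>
    LinearMap.toMatrix_mulVec_repr b b T z
  have key := exp_mulVec_of_rotation (LinearMap.toMatrix b b T) (b.repr x) (b.repr y) (k := k)
    (by rw [hT, hx, map_smul]; rfl) (by rw [hT, hy, map_smul]; rfl)
  apply b.repr.injective
  apply DFunLike.coe_injective
  have := LinearMap.toMatrix_mulVec_repr b b (expEnd T) x
  rw [← this, expEnd, LinearMap.toMatrix_toLin, key]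
  simp

lemma expEnd_apply_of_eq_zero {T : Module.End ℝ V} {x : V} (h : T x = 0) : expEnd T x = x := by
  simpa using expEnd_apply_of_rotation (T := T) (x := x) (y := 0) (k := 0) (by simpa) (by simp)

lemma commute_expEnd {S T : Module.End ℝ V} (h : Commute S T) : Commute S (expEnd T) := by
  set b := Module.finBasis ℝ V
  have h1 : Commute (LinearMap.toMatrix b b S) (LinearMap.toMatrix b b T) := by
    rw [Commute, SemiconjBy, ← LinearMap.toMatrix_mul, ← LinearMap.toMatrix_mul, h.eq]
  have h2 := h1.exp_right
  apply (LinearMap.toMatrix b b).injective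
  rw [LinearMap.toMatrix_mul, LinearMap.toMatrix_mul, expEnd, LinearMap.toMatrix_toLin]
  exact h2.eq

end ExpEnd

/-! ### Root spaces and the Cartan involution -/

section RootSpaces

variable {𝔤 : Type*} [LieRing 𝔤] [LieAlgebra ℝ 𝔤] [FiniteDimensional ℝ 𝔤]
  [LieAlgebra.IsKilling ℝ 𝔤]
variable {A : LieSubalgebra ℝ 𝔤} [A.IsCartanSubalgebra] [LieModule.IsTriangularizable ℝ A 𝔤]

lemma mem_rootSpace_of_forall_lie {χ : A → ℝ} {x : 𝔤} (h : ∀ H : A, ⁅(H : 𝔤), x⁆ = χ H • x) :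
    x ∈ rootSpace A χ := by
  apply LieModule.weightSpace_le_genWeightSpace
  rw [LieModule.mem_weightSpace]
  exact h

lemma lie_of_mem_rootSpace {χ : A → ℝ} {x : 𝔤} (hx : x ∈ rootSpace A χ) (H : A) :
    ⁅(H : 𝔤), x⁆ = χ H • x :=
  LieAlgebra.IsKilling.lie_eq_smul_of_mem_rootSpace hx H

lemma exists_weight_of_mem_rootSpace {χ : A → ℝ} {x : 𝔤} (hx : x ∈ rootSpace A χ) (h0 : x ≠ 0) :
    ∃ ψ : Weight ℝ A 𝔤, (ψ : A → ℝ) = χ := by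
  refine ⟨⟨χ, fun h => h0 ?_⟩, rfl⟩
  have : x ∈ (⊥ : LieSubmodule ℝ A 𝔤) := h ▸ hx
  simpa using this

lemma lie_mem_rootSpace {χ ψ : A → ℝ} {x y : 𝔤} (hx : x ∈ rootSpace A χ)
    (hy : y ∈ rootSpace A ψ) : ⁅x, y⁆ ∈ rootSpace A (χ + ψ) :=
  LieAlgebra.lie_mem_genWeightSpace_of_mem_genWeightSpace hx hy

lemma exists_eq_smul_of_mem_rootSpace {α : Weight ℝ A 𝔤} (hα : α.IsNonZero) {x y : 𝔤}
    (hx : x ∈ rootSpace A α) (h0 : x ≠ 0) (hy : y ∈ rootSpace A α) : ∃ c : ℝ, y = c • x := by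
  have h1 := finrank_rootSpace_eq_one α hα
  obtain ⟨c, hc⟩ := (finrank_eq_one_iff_of_nonzero' (⟨x, hx⟩ : rootSpace A α)
    (by simpa [LieSubmodule.mk_eq_zero] using h0)).1 h1 ⟨y, hy⟩
  exact ⟨c, (congrArg Subtype.val hc).symm⟩

lemma weight_induction {p : 𝔤 → Prop} (hadd : ∀ x y, p x → p y → p (x + y)) (h0 : p 0)
    (hmem : ∀ (χ : Weight ℝ A 𝔤) (x : 𝔤), x ∈ rootSpace A χ → p x) (x : 𝔤) : p x := by
  have hx : x ∈ ⨆ χ : Weight ℝ A 𝔤, rootSpace A χ := by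
    rw [LieModule.iSup_genWeightSpace_eq_top' ℝ A 𝔤]; trivial
  refine LieSubmodule.iSup_induction _ (motive := p) hx hmem h0 hadd

lemma IsCartanInvolution.mem_rootSpace_neg {θ : 𝔤 →ₗ⁅ℝ⁆ 𝔤} (hθ : IsCartanInvolution A θ)
    {χ : A → ℝ} {x : 𝔤} (hx : x ∈ rootSpace A χ) :
    θ x ∈ rootSpace A (-χ) := by
  refine mem_rootSpace_of_forall_lie fun H => ?_
  have h := congrArg θ (lie_of_mem_rootSpace hx H)
  rw [LieHom.map_lie, hθ.apply_cartan, neg_lie, map_smul, neg_eq_iff_eq_neg] at h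
  rw [h, Pi.neg_apply, neg_smul]

/-- A `θ`-adapted `sl₂`-triple for a root. -/
lemma IsCartanInvolution.exists_triple {θ : 𝔤 →ₗ⁅ℝ⁆ 𝔤} (hθ : IsCartanInvolution A θ)
    (γ : A.root) :
    ∃ e f : 𝔤, e ∈ rootSpace A γ.1 ∧ f ∈ rootSpace A (-γ.1 : A → ℝ) ∧ e ≠ 0 ∧
      ⁅e, f⁆ = (coroot γ.1 : 𝔤) ∧ θ e = -f ∧ θ f = -e := by
  have hγ : γ.1.IsNonZero := A.isNonZero_coe_root γ
  obtain ⟨h, e, f, ht, he, hf⟩ := exists_isSl2Triple_of_weight_isNonZero hγ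
  have hh := ht.h_eq_coroot hγ he hf
  obtain ⟨s, hs⟩ := exists_eq_smul_of_mem_rootSpace (α := -γ.1) hγ.neg hf ht.f_ne_zero
    (hθ.mem_rootSpace_neg he)
  -- This fixes the sign of `s`: κ(e, f) is half of κ(h, h) = -κ(h, θ h) > 0, while s κ(e, f) = κ(e,
  -- θ e) < 0. So `s` is negative, and rescaling by √(-s) makes θ e = -f, which puts e - f in 𝔨.
  have h1 : 2 * killingForm ℝ 𝔤 e f = killingForm ℝ 𝔤 h h := by
    have := LieModule.traceForm_apply_lie_apply ℝ 𝔤 𝔤 h e f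
    rw [ht.lie_e_f, ht.lie_h_e_nsmul] at this
    rw [show killingForm ℝ 𝔤 h h = _ from this.symm]
    simp
  have h2 : 0 < killingForm ℝ 𝔤 h h := by
    have := hθ.neg_of_ne_zero h ht.h_ne_zero
    rw [hh, hθ.apply_cartan, ← hh, map_neg] at this
    linarith
  have h3 := hθ.neg_of_ne_zero e ht.e_ne_zero
  rw [hs, map_smul, smul_eq_mul] at h3
  have hs0 : 0 < -s := by nlinarith
  set r := Real.sqrt (-s)
  have hr : 0 < r := Real.sqrt_pos.2 hs0
  have hr2 : r * r = -s := Real.mul_self_sqrt hs0.le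
  have hθe : θ (r⁻¹ • e) = -(r • f) := by
    rw [map_smul, hs, smul_smul, ← neg_smul]
    congr 1
    field_simp
    linarith
  refine ⟨r⁻¹ • e, r • f, Submodule.smul_mem _ _ he, Submodule.smul_mem _ _ hf, ?_, ?_, hθe, ?_⟩
  · exact smul_ne_zero (inv_ne_zero hr.ne') ht.e_ne_zero
  · rw [smul_lie, lie_smul, smul_smul, inv_mul_cancel₀ hr.ne', one_smul, ht.lie_e_f, hh]
  · rw [← neg_eq_iff_eq_neg, ← map_neg, ← hθe, hθ.involutive]

end RootSpaces

/-! ### Half turns in long roots as elements of M -/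

section Reflections

variable {𝔤 : Type*} [LieRing 𝔤] [LieAlgebra ℝ 𝔤] [FiniteDimensional ℝ 𝔤]
  [LieAlgebra.IsKilling ℝ 𝔤]
variable {A : LieSubalgebra ℝ 𝔤} [A.IsCartanSubalgebra] [LieModule.IsTriangularizable ℝ A 𝔤]

/-- The root `γ` is long in its irreducible component: no root other than `±γ` has Cartan integer
with `γ` of absolute value greater than one. -/
def IsLong (γ : A.root) : Prop :=
  ∀ α : A.root, α ≠ γ → α ≠ negRoot A γ →
    α.1 (coroot γ.1) = 0 ∨ α.1 (coroot γ.1) = 1 ∨ α.1 (coroot γ.1) = -1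

lemma root_apply_coroot_self (γ : A.root) : γ.1 (coroot γ.1) = 2 :=
  root_apply_coroot (A.isNonZero_coe_root γ)

/-- A nonzero vector would make `χ` a weight, but the zero weight has Cartan integer 0 and `IsLong`
bounds it by 1 on all roots other than ±γ. This truncates the γ-strings below, in place of the
representation theory of sl₂. -/
lemma eq_zero_of_mem_rootSpace_of_isLong {γ : A.root} (hγ : IsLong γ) {χ : A → ℝ} {x : 𝔤}
    (hx : x ∈ rootSpace A χ) (h : 1 < |χ (coroot γ.1)|) (h1 : χ ≠ γ.1) (h2 : χ ≠ -γ.1) :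
    x = 0 := by
  by_contra h0
  obtain ⟨ψ, rfl⟩ := exists_weight_of_mem_rootSpace hx h0
  by_cases hψ : ψ.IsZero
  · rw [hψ] at h; norm_num at h
  · have := hγ ⟨ψ, by simpa using hψ⟩ (fun e => h1 (congrArg (fun z : A.root => (z.1 : A → ℝ)) e))
      (fun e => h2 (congrArg (fun z : A.root => (z.1 : A → ℝ)) e))
    rcases this with e | e | e <;> simp only [e] at h <;> norm_num at h

/-- The half turn `exp (π ad (e - f))` in the `SL₂` of a long root acts on each weight space by a
sign. -/
lemma expEnd_apply_of_isLong {γ : A.root} (hγ : IsLong γ) {e f : 𝔤} (he : e ∈ rootSpace A γ.1)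
    (hf : f ∈ rootSpace A (-γ.1 : A → ℝ)) (he0 : e ≠ 0) (hf0 : f ≠ 0)
    (hef : ⁅e, f⁆ = (coroot γ.1 : 𝔤)) (χ : Weight ℝ A 𝔤) {x : 𝔤} (hx : x ∈ rootSpace A χ) :
    expEnd (LieAlgebra.ad ℝ 𝔤 (Real.pi • (e - f))) x = Real.cos (Real.pi * χ (coroot γ.1)) • x := by
  set h : A := coroot γ.1
  have hγh : γ.1 h = 2 := root_apply_coroot_self γ
  have hγ0 : γ.1.IsNonZero := A.isNonZero_coe_root γ
  set T := LieAlgebra.ad ℝ 𝔤 (Real.pi • (e - f))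
  have hT : ∀ z, T z = Real.pi • (⁅e, z⁆ - ⁅f, z⁆) := fun z => by
    simp only [T, LieAlgebra.ad_apply, smul_lie, sub_lie]
  have hhe : ⁅(h : 𝔤), e⁆ = (2 : ℝ) • e := by rw [lie_of_mem_rootSpace he, hγh]
  have hhf : ⁅(h : 𝔤), f⁆ = (-2 : ℝ) • f := by rw [lie_of_mem_rootSpace hf, Pi.neg_apply, hγh]
  have hTe : T e = Real.pi • (h : 𝔤) := by rw [hT, lie_self, ← lie_skew, hef]; simp
  have hTf : T f = Real.pi • (h : 𝔤) := by rw [hT, lie_self, hef]; simp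
  have hTh : T h = -(2 * Real.pi) • (e + f) := by
    rw [hT, ← lie_skew, ← lie_skew f, hhe, hhf]; module
  -- `T` turns the plane of `h` and `e + f` through the angle 2π and kills `e - f`, so its
  -- exponential fixes the whole triple.
  have hexp_e_add : expEnd T (e + f) = e + f := by
    rw [expEnd_apply_of_rotation (y := (h : 𝔤)) (k := 2 * Real.pi) _ hTh]
    · simp
    · rw [map_add, hTe, hTf]; module
  have hexp_e_sub : expEnd T (e - f) = e - f :=
    expEnd_apply_of_eq_zero (by rw [map_sub, hTe, hTf, sub_self])
  have hexp_h : expEnd T h = h := by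
    rw [expEnd_apply_of_rotation (y := -(e + f)) (k := 2 * Real.pi)]
    · simp
    · rw [hTh]; module
    · rw [map_neg, map_add, hTe, hTf]; module
  have hexp_e : expEnd T e = e := by
    have : e = (2⁻¹ : ℝ) • ((e + f) + (e - f)) := by module
    conv_lhs => rw [this, map_smul, map_add, hexp_e_add, hexp_e_sub, ← this]
  have hexp_f : expEnd T f = f := by
    have : f = (2⁻¹ : ℝ) • ((e + f) - (e - f)) := by module
    conv_lhs => rw [this, map_smul, map_sub, hexp_e_add, hexp_e_sub, ← this]
  by_cases hχ : χ.IsZero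
  · have hx' : x ∈ rootSpace A (0 : A → ℝ) := by rw [← show (χ : A → ℝ) = 0 from hχ]; exact hx
    rw [LieAlgebra.rootSpace_zero_eq, LieSubalgebra.mem_toLieSubmodule] at hx'
    lift x to A using hx'
    -- Removing the multiple of `h` from an element of 𝔞 leaves an element of ker γ, which commutes
    -- with `e` and `f`.
    have h0 : expEnd T ((x - (γ.1 x / 2) • h : A) : 𝔤) = ((x - (γ.1 x / 2) • h : A) : 𝔤) := by
      apply expEnd_apply_of_eq_zero
      have hz : γ.1 (x - (γ.1 x / 2) • h : A) = 0 := by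
        rw [map_sub, map_smul, hγh]; simp
      rw [hT, ← lie_skew, ← lie_skew f, lie_of_mem_rootSpace he, lie_of_mem_rootSpace hf,
        Pi.neg_apply, hz]
      simp
    rw [show ((x - (γ.1 x / 2) • h : A) : 𝔤) = x - (γ.1 x / 2) • (h : 𝔤) from rfl, map_sub, map_smul, hexp_h,
      sub_left_inj] at h0
    rw [h0, show (χ : A → ℝ) = 0 from hχ]
    simp
  by_cases hχ1 : (χ : A → ℝ) = γ.1
  · rw [hχ1] at hx ⊢
    obtain ⟨c, rfl⟩ := exists_eq_smul_of_mem_rootSpace hγ0 he he0 hx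
    rw [map_smul, hexp_e, hγh, mul_comm, Real.cos_two_pi, one_smul]
  by_cases hχ2 : (χ : A → ℝ) = -γ.1
  · rw [hχ2] at hx ⊢
    obtain ⟨c, rfl⟩ := exists_eq_smul_of_mem_rootSpace (α := -γ.1) hγ0.neg hf hf0 hx
    rw [map_smul, hexp_f, Pi.neg_apply, hγh, mul_neg, Real.cos_neg, mul_comm, Real.cos_two_pi,
      one_smul]
  have hne : ∀ {a b : A → ℝ}, a h ≠ b h → a ≠ b := fun hab e => hab (by rw [e])
  have hlie : ∀ z : 𝔤, ⁅e, ⁅f, z⁆⁆ = ⁅(h : 𝔤), z⁆ + ⁅f, ⁅e, z⁆⁆ := fun z => by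
    rw [leibniz_lie, hef]
  have hhx : ⁅(h : 𝔤), x⁆ = χ h • x := lie_of_mem_rootSpace hx h
  have hex := lie_mem_rootSpace he hx
  have hfx := lie_mem_rootSpace hf hx
  have heex := lie_mem_rootSpace he hex
  have hffx := lie_mem_rootSpace hf hfx
  rcases hγ ⟨χ, by simpa using hχ⟩
    (fun e => hχ1 (congrArg (fun z : A.root => (z.1 : A → ℝ)) e))
    (fun e => hχ2 (congrArg (fun z : A.root => (z.1 : A → ℝ)) e)) with hn | hn | hn <;>
    simp only at hn
  -- Cartan integer 0: the neighbours χ ± γ would have Cartan integer ±2 without being ±γ, so `e`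
  -- and `f` kill `x`.
  · have hχ0 : (χ : A → ℝ) ≠ 0 := hχ
    have h1 : ⁅e, x⁆ = 0 := by
      refine eq_zero_of_mem_rootSpace_of_isLong hγ hex ?_ ?_ ?_
      · rw [Pi.add_apply, hγh, hn]; norm_num
      · simpa using hχ0
      · apply hne; rw [Pi.add_apply, Pi.neg_apply, hγh, hn]; norm_num
    have h2 : ⁅f, x⁆ = 0 := by
      refine eq_zero_of_mem_rootSpace_of_isLong hγ hfx ?_ ?_ ?_
      · rw [Pi.add_apply, Pi.neg_apply, hγh, hn]; norm_num
      · apply hne; rw [Pi.add_apply, Pi.neg_apply, hγh, hn]; norm_num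
      · simpa using hχ0
    rw [expEnd_apply_of_eq_zero (by rw [hT, h1, h2]; simp), hn]
    simp
  -- Cartan integer 1: the string is χ, χ - γ, and `T` turns the plane of `x` and [f, x] through π,
  -- giving the sign -1. The last case is symmetric.
  · have h1 : ⁅e, x⁆ = 0 := by
      refine eq_zero_of_mem_rootSpace_of_isLong hγ hex ?_ ?_ ?_
      · rw [Pi.add_apply, hγh, hn]; norm_num
      · apply hne; rw [Pi.add_apply, hγh, hn]; norm_num
      · apply hne; rw [Pi.add_apply, Pi.neg_apply, hγh, hn]; norm_num
    have h2 : ⁅f, ⁅f, x⁆⁆ = 0 := by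
      refine eq_zero_of_mem_rootSpace_of_isLong hγ hffx ?_ ?_ ?_
      · rw [Pi.add_apply, Pi.add_apply, Pi.neg_apply, hγh, hn]; norm_num
      · apply hne; rw [Pi.add_apply, Pi.add_apply, Pi.neg_apply, hγh, hn]; norm_num
      · apply hne; rw [Pi.add_apply, Pi.add_apply, Pi.neg_apply, hγh, hn]; norm_num
    rw [expEnd_apply_of_rotation (k := Real.pi) (y := -⁅f, x⁆), hn]
    · simp
    · rw [hT, h1]; module
    · rw [map_neg, hT, h2, hlie, h1, hhx, hn]; simp
  · have h1 : ⁅f, x⁆ = 0 := by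
      refine eq_zero_of_mem_rootSpace_of_isLong hγ hfx ?_ ?_ ?_
      · rw [Pi.add_apply, Pi.neg_apply, hγh, hn]; norm_num
      · apply hne; rw [Pi.add_apply, Pi.neg_apply, hγh, hn]; norm_num
      · apply hne; rw [Pi.add_apply, Pi.neg_apply, hγh, hn]; norm_num
    have h2 : ⁅e, ⁅e, x⁆⁆ = 0 := by
      refine eq_zero_of_mem_rootSpace_of_isLong hγ heex ?_ ?_ ?_
      · rw [Pi.add_apply, Pi.add_apply, hγh, hn]; norm_num
      · apply hne; rw [Pi.add_apply, Pi.add_apply, hγh, hn]; norm_num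
      · apply hne; rw [Pi.add_apply, Pi.add_apply, Pi.neg_apply, hγh, hn]; norm_num
    have h3 : ⁅f, ⁅e, x⁆⁆ = x := by
      have := hlie x
      rw [h1, lie_zero, hhx, hn, neg_one_smul, eq_comm, neg_add_eq_zero] at this
      exact this.symm
    rw [expEnd_apply_of_rotation (k := Real.pi) (y := ⁅e, x⁆), hn]
    · simp
    · rw [hT, h1, sub_zero]
    · rw [hT, h2, h3]; simp

lemma exists_int_apply_coroot (γ : A.root) (χ : Weight ℝ A 𝔤) :
    ∃ n : ℤ, χ (coroot γ.1) = n :=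
  ⟨_, apply_coroot_eq_cast γ.1 χ⟩

/-- The half turn of a long root as an element of `M`. -/
lemma IsCartanInvolution.exists_groupM_of_isLong {θ : 𝔤 →ₗ⁅ℝ⁆ 𝔤} (hθ : IsCartanInvolution A θ)
    {γ : A.root} (hγ : IsLong γ) :
    ∃ m : groupM A θ, ∀ (χ : Weight ℝ A 𝔤) (x : 𝔤), x ∈ rootSpace A χ →
      adRep A θ m x = Real.cos (Real.pi * χ (coroot γ.1)) • x := by
  obtain ⟨e, f, he, hf, he0, hef, hθe, hθf⟩ := hθ.exists_triple γ
  have hf0 : f ≠ 0 := by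
    rintro rfl
    rw [map_zero, eq_comm, neg_eq_zero] at hθf
    exact he0 hθf
  set φ := expEnd (LieAlgebra.ad ℝ 𝔤 (Real.pi • (e - f))) with hφ_def
  have hφ : ∀ (χ : Weight ℝ A 𝔤) (x : 𝔤), x ∈ rootSpace A χ →
      φ x = Real.cos (Real.pi * χ (coroot γ.1)) • x :=
    fun χ x hx => expEnd_apply_of_isLong hγ he hf he0 hf0 hef χ hx
  have hcos : ∀ n : ℤ, Real.cos (Real.pi * n) = 1 ∨ Real.cos (Real.pi * n) = -1 := fun n => by
    rw [mul_comm, Real.cos_int_mul_pi]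
    exact (Int.even_or_odd n).imp (fun h => h.neg_one_zpow) fun h => h.neg_one_zpow
  have hinv : Function.Involutive φ := by
    intro x
    refine weight_induction (A := A) (p := fun x => φ (φ x) = x) ?_ ?_ ?_ x
    · intro x y hx hy; simp only [map_add, hx, hy]
    · simp
    · intro χ x hx
      obtain ⟨n, hn⟩ := exists_int_apply_coroot γ χ
      rw [hφ χ x hx, map_smul, hφ χ x hx, smul_smul, hn]
      rcases hcos n with h | h <;> simp [h]
  -- The signs are multiplicative in the weight: in the addition formula for the cosine the sine
  -- terms vanish at integer multiples of π.
  have hlie : ∀ x y : 𝔤, φ ⁅x, y⁆ = ⁅φ x, φ y⁆ := by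
    intro x y
    refine weight_induction (A := A) (p := fun x => φ ⁅x, y⁆ = ⁅φ x, φ y⁆) ?_ ?_ ?_ x
    · intro x x' hx hx'; simp only [add_lie, map_add, hx, hx']
    · simp
    intro χ x hx
    refine weight_induction (A := A) (p := fun y => φ ⁅x, y⁆ = ⁅φ x, φ y⁆) ?_ ?_ ?_ y
    · intro y y' hy hy'; simp only [lie_add, map_add, hy, hy']
    · simp
    intro ψ y hy
    rw [hφ χ x hx, hφ ψ y hy]
    by_cases h0 : ⁅x, y⁆ = 0
    · simp [h0]
    obtain ⟨ω, hω⟩ := exists_weight_of_mem_rootSpace (lie_mem_rootSpace hx hy) h0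
    rw [hφ ω _ (hω ▸ lie_mem_rootSpace hx hy), hω, smul_lie, lie_smul, smul_smul, Pi.add_apply]
    obtain ⟨n, hn⟩ := exists_int_apply_coroot γ χ
    rw [hn, mul_add, Real.cos_add, mul_comm Real.pi n, Real.sin_int_mul_pi]
    simp
  let Φ : 𝔤 ≃ₗ[ℝ] 𝔤 := LinearEquiv.ofInvolutive φ hinv
  have hΦ : ∀ x, Φ x = φ x := fun x => rfl
  have hK : Φ ∈ groupK θ := by
    refine Subgroup.subset_closure ⟨⟨Real.pi • (e - f), ?_, ?_⟩, hlie⟩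
    · rw [map_smul, map_sub, hθe, hθf]; module
    · ext x; rfl
  refine ⟨⟨⟨Φ, hK⟩, fun H => ?_⟩, fun χ x hx => hφ χ x hx⟩
  change φ H = H
  have hH : (H : 𝔤) ∈ rootSpace A (0 : A → ℝ) := by
    rw [LieAlgebra.rootSpace_zero_eq, LieSubalgebra.mem_toLieSubmodule]; exact H.2
  by_cases h0 : (H : 𝔤) = 0
  · rw [h0, map_zero]
  obtain ⟨ω, hω⟩ := exists_weight_of_mem_rootSpace hH h0
  rw [hφ ω _ (hω ▸ hH), hω]
  simp

end Reflections

/-! ### Linear algebra of generalized complex structures -/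

section Generalized

variable {ι N : Type*} [AddCommGroup N] [Module ℝ N]

/-- Twice the natural inner product on `N ⊕ N*`. -/
def genForm (N : Type*) [AddCommGroup N] [Module ℝ N] :
    LinearMap.BilinForm ℝ (N × Module.Dual ℝ N) :=
  LinearMap.mk₂ ℝ (fun v w => v.2 w.1 + w.2 v.1)
    (fun _ _ _ => by simp; ring) (fun _ _ _ => by simp; ring)
    (fun _ _ _ => by simp; ring) (fun _ _ _ => by simp; ring)

lemma genForm_apply (v w : N × Module.Dual ℝ N) : genForm N v w = v.2 w.1 + w.2 v.1 := rfl

lemma genForm_comm (v w : N × Module.Dual ℝ N) : genForm N v w = genForm N w v := by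
  rw [genForm_apply, genForm_apply, add_comm]

variable (b : Module.Basis ι ℝ N)

/-- The frame `(b_α, b_β, b_α*, b_β*)`. -/
noncomputable def genFrame (α β : ι) : Fin 4 → N × Module.Dual ℝ N :=
  ![(b α, 0), (b β, 0), (0, b.coord α), (0, b.coord β)]

/-- `J` preserves the span of the frame at `α`, `β` and has matrix `P` there. -/
def HasBlock (J : Module.End ℝ (N × Module.Dual ℝ N)) (α β : ι)
    (P : Matrix (Fin 4) (Fin 4) ℝ) : Prop :=
  ∀ j, J (genFrame b α β j) = ∑ i, P i j • genFrame b α β i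

lemma hasBlock_iff {J : Module.End ℝ (N × Module.Dual ℝ N)} {α β : ι}
    {P : Matrix (Fin 4) (Fin 4) ℝ} :
    HasBlock b J α β P ↔ ∀ j, J (genFrame b α β j) = P 0 j • (b α, 0) + P 1 j • (b β, 0) +
      P 2 j • (0, b.coord α) + P 3 j • (0, b.coord β) := by
  simp only [HasBlock, Fin.sum_univ_four]
  rfl

lemma hasBlock_complexMatrix_iff {J : Module.End ℝ (N × Module.Dual ℝ N)} {α β : ι} {s c : ℝ} :
    HasBlock b J α β (complexMatrix s c) ↔
      J (b α, 0) = s • (b α, 0) + c • (b β, 0) ∧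
      J (b β, 0) = (-(1 + s ^ 2) / c) • (b α, 0) + (-s) • (b β, 0) ∧
      J (0, b.coord α) = (-s) • (0, b.coord α) + ((1 + s ^ 2) / c) • (0, b.coord β) ∧
      J (0, b.coord β) = (-c) • (0, b.coord α) + s • (0, b.coord β) := by
  rw [hasBlock_iff, Fin.forall_fin_succ, Fin.forall_fin_succ, Fin.forall_fin_succ,
    Fin.forall_fin_one]
  simp [genFrame, complexMatrix]

lemma hasBlock_noncomplexMatrix_iff {J : Module.End ℝ (N × Module.Dual ℝ N)} {α β : ι}
    {a x y : ℝ} :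
    HasBlock b J α β (noncomplexMatrix a x y) ↔
      J (b α, 0) = a • (b α, 0) + y • (0, b.coord β) ∧
      J (b β, 0) = a • (b β, 0) + (-y) • (0, b.coord α) ∧
      J (0, b.coord α) = x • (b β, 0) + (-a) • (0, b.coord α) ∧
      J (0, b.coord β) = (-x) • (b α, 0) + (-a) • (0, b.coord β) := by
  rw [hasBlock_iff, Fin.forall_fin_succ, Fin.forall_fin_succ, Fin.forall_fin_succ,
    Fin.forall_fin_one]
  simp [genFrame, noncomplexMatrix]

/-- A generalized complex structure on a vector space. -/
structure IsGenComplex (J : Module.End ℝ (N × Module.Dual ℝ N)) : Prop where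
  apply_apply (v) : J (J v) = -v
  orthogonal (v w) : genForm N (J v) (J w) = genForm N v w

variable {b}

lemma IsGenComplex.skew {J : Module.End ℝ (N × Module.Dual ℝ N)} (hJ : IsGenComplex J)
    (v w : N × Module.Dual ℝ N) : genForm N (J v) w = -genForm N v (J w) := by
  rw [← hJ.orthogonal (J v) w, hJ.apply_apply, map_neg, LinearMap.neg_apply]

lemma IsGenComplex.self_eq_zero {J : Module.End ℝ (N × Module.Dual ℝ N)} (hJ : IsGenComplex J)
    (v : N × Module.Dual ℝ N) : genForm N (J v) v = 0 := by
  have := hJ.skew v v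
  rw [genForm_comm v] at this
  linarith

variable (b)

section Gram

variable (α β : ι)

lemma genForm_vec_vec : genForm N (b α, 0) (b β, 0) = 0 := by simp [genForm_apply]

lemma genForm_covec_covec : genForm N (0, b.coord α) (0, b.coord β) = 0 := by
  simp [genForm_apply]

lemma genForm_vec_covec_self : genForm N (b α, 0) (0, b.coord α) = 1 := by simp [genForm_apply]

lemma genForm_covec_vec_self : genForm N (0, b.coord α) (b α, 0) = 1 := by simp [genForm_apply]

variable {α β}

lemma genForm_vec_covec_of_ne (h : α ≠ β) : genForm N (b α, 0) (0, b.coord β) = 0 := by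
  simp [genForm_apply, h]

lemma genForm_covec_vec_of_ne (h : α ≠ β) : genForm N (0, b.coord α) (b β, 0) = 0 := by
  simp [genForm_apply, h.symm]

end Gram

variable [Fintype ι]

/-- For the neutral form the frame of vectors and covectors is self-dual, each vector being dual to
its own covector; hence the coordinates are pairings with the opposite members. -/
lemma eq_sum_genForm (v : N × Module.Dual ℝ N) :
    v = ∑ γ, (genForm N v (0, b.coord γ) • ((b γ, 0) : N × Module.Dual ℝ N) +
      genForm N v (b γ, 0) • (0, b.coord γ)) := by
  classical
  have h1 : v.1 = ∑ γ, b.coord γ v.1 • b γ := (b.sum_repr v.1).symm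
  have h2 : v.2 = ∑ γ, v.2 (b γ) • b.coord γ := by
    apply b.ext
    intro i
    simp
  apply Prod.ext
  · rw [Prod.fst_sum]
    conv_lhs => rw [h1]
    refine Finset.sum_congr rfl fun γ _ => ?_
    simp [genForm_apply]
  · rw [Prod.snd_sum]
    conv_lhs => rw [h2]
    refine Finset.sum_congr rfl fun γ _ => ?_
    simp [genForm_apply]

lemma genForm_eq_sum (v w : N × Module.Dual ℝ N) :
    genForm N v w = ∑ γ, (genForm N v (0, b.coord γ) * genForm N w (b γ, 0) +
      genForm N v (b γ, 0) * genForm N w (0, b.coord γ)) := by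
  conv_lhs => rw [eq_sum_genForm b v]
  rw [map_sum, LinearMap.sum_apply]
  refine Finset.sum_congr rfl fun γ _ => ?_
  rw [map_add, LinearMap.add_apply, map_smul, map_smul, LinearMap.smul_apply,
    LinearMap.smul_apply, genForm_comm _ w, genForm_comm _ w]
  rfl

/-- `v` has no components outside the span of the frame at `α`, `β`. -/
lemma eq_of_genForm_eq_zero {α β : ι} (hαβ : α ≠ β) (v : N × Module.Dual ℝ N)
    (h : ∀ γ, γ ≠ α → γ ≠ β → genForm N v (0, b.coord γ) = 0 ∧ genForm N v (b γ, 0) = 0) :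
    v = genForm N v (0, b.coord α) • ((b α, 0) : N × Module.Dual ℝ N) +
      genForm N v (0, b.coord β) • (b β, 0) +
      genForm N v (b α, 0) • (0, b.coord α) + genForm N v (b β, 0) • (0, b.coord β) := by
  classical
  conv_lhs => rw [eq_sum_genForm b v]
  rw [← Finset.sum_subset (Finset.subset_univ {α, β}), Finset.sum_pair hαβ]
  · abel
  · intro γ _ hγ
    simp only [Finset.mem_insert, Finset.mem_singleton, not_or] at hγ
    obtain ⟨h1, h2⟩ := h γ hγ.1 hγ.2
    rw [h1, h2, zero_smul, zero_smul, add_zero]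

variable {b}
variable {J J' : Module.End ℝ (N × Module.Dual ℝ N)}

/-- A generalized complex structure does not preserve the sum of a line and its dual. -/
lemma IsGenComplex.not_preserves_line (hJ : IsGenComplex J) (α : ι)
    (h : ∀ γ, γ ≠ α → genForm N (J (b α, 0)) (0, b.coord γ) = 0 ∧
      genForm N (J (b α, 0)) (b γ, 0) = 0) : False := by
  classical
  -- The covector coefficient vanishes because `J` is skew. What remains is J X_α = p X_α, whence p²
  -- = -1.
  have h0 := hJ.self_eq_zero (b α, 0)
  have h1 : J (b α, 0) = genForm N (J (b α, 0)) (0, b.coord α) • (b α, 0) := by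
    conv_lhs => rw [eq_sum_genForm b (J (b α, 0))]
    rw [Finset.sum_eq_single α, h0, zero_smul, add_zero]
    · intro γ _ hγ
      rw [(h γ hγ).1, (h γ hγ).2, zero_smul, zero_smul, add_zero]
    · simp
  set p := genForm N (J (b α, 0)) (0, b.coord α)
  have h2 := hJ.apply_apply (b α, 0)
  rw [h1, map_smul, h1, smul_smul] at h2
  have h3 := congrArg (fun v => genForm N v (0, b.coord α)) h2
  simp only [map_smul, map_neg, LinearMap.smul_apply, LinearMap.neg_apply, smul_eq_mul,
    genForm_vec_covec_self] at h3
  nlinarith [mul_self_nonneg p]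

/-- A generalized complex structure on a plane is of complex or of noncomplex type. -/
lemma IsGenComplex.complex_or_noncomplex (hJ : IsGenComplex J) {α β : ι} (hαβ : α ≠ β)
    (h : ∀ δ, δ = α ∨ δ = β → ∀ γ, γ ≠ α → γ ≠ β →
      genForm N (J (b δ, 0)) (0, b.coord γ) = 0 ∧ genForm N (J (b δ, 0)) (b γ, 0) = 0 ∧
      genForm N (J (0, b.coord δ)) (0, b.coord γ) = 0 ∧
      genForm N (J (0, b.coord δ)) (b γ, 0) = 0) :
    (∃ s c, c ≠ 0 ∧ HasBlock b J α β (complexMatrix s c)) ∨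
    ∃ a x y, a ^ 2 = x * y - 1 ∧ HasBlock b J α β (noncomplexMatrix a x y) := by
  have e0 := eq_of_genForm_eq_zero b hαβ (J (b α, 0)) fun γ h1 h2 =>
    ⟨(h α (.inl rfl) γ h1 h2).1, (h α (.inl rfl) γ h1 h2).2.1⟩
  have e1 := eq_of_genForm_eq_zero b hαβ (J (b β, 0)) fun γ h1 h2 =>
    ⟨(h β (.inr rfl) γ h1 h2).1, (h β (.inr rfl) γ h1 h2).2.1⟩
  have e2 := eq_of_genForm_eq_zero b hαβ (J (0, b.coord α)) fun γ h1 h2 =>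
    ⟨(h α (.inl rfl) γ h1 h2).2.2.1, (h α (.inl rfl) γ h1 h2).2.2.2⟩
  have e3 := eq_of_genForm_eq_zero b hαβ (J (0, b.coord β)) fun γ h1 h2 =>
    ⟨(h β (.inr rfl) γ h1 h2).2.2.1, (h β (.inr rfl) γ h1 h2).2.2.2⟩
  -- Skewness expresses all sixteen entries through the six numbers `p`, `r`, `q`, `t`, `y`, `x`
  -- named below; `x` is the coefficient of X_β in J X_α*.
  rw [hJ.skew (0, b.coord α) (b α, 0), hJ.skew (0, b.coord α) (b β, 0), hJ.self_eq_zero,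
    genForm_comm _ (J _), genForm_comm _ (J (b β, 0))] at e2
  rw [hJ.skew (0, b.coord β) (b α, 0), hJ.skew (0, b.coord β) (b β, 0), hJ.self_eq_zero,
    hJ.skew (0, b.coord β) (0, b.coord α), genForm_comm _ (J (b α, 0)),
    genForm_comm _ (J (b β, 0)), genForm_comm _ (J (0, b.coord α))] at e3
  rw [hJ.self_eq_zero] at e0
  rw [hJ.self_eq_zero, hJ.skew (b β, 0) (b α, 0), genForm_comm _ (J (b α, 0))] at e1
  generalize genForm N (J (b α, 0)) (0, b.coord α) = p at *
  generalize genForm N (J (b α, 0)) (0, b.coord β) = r at *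
  generalize genForm N (J (b β, 0)) (0, b.coord α) = q at *
  generalize genForm N (J (b β, 0)) (0, b.coord β) = t at *
  generalize genForm N (J (b α, 0)) (b β, 0) = y at *
  generalize genForm N (J (0, b.coord α)) (0, b.coord β) = x at *
  have f0 := hJ.apply_apply (b α, 0)
  have f1 := hJ.apply_apply (b β, 0)
  have f2 := hJ.apply_apply (0, b.coord α)
  simp only [e0, e1, e2, e3, map_add, map_smul] at f0 f1 f2
  have hβα := hαβ.symm
  have k : ∀ {v w : N × Module.Dual ℝ N}, v = w → ∀ u, genForm N v u = genForm N w u :=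
    fun h u => by rw [h]
  have g1 := k f0 (0, b.coord α)
  have g2 := k f0 (0, b.coord β)
  have g3 := k f0 (b α, 0)
  have g4 := k f0 (b β, 0)
  have g5 := k f1 (0, b.coord α)
  have g6 := k f1 (0, b.coord β)
  have g7 := k f1 (b β, 0)
  have g8 := k f2 (0, b.coord α)
  have g9 := k f2 (0, b.coord β)
  simp only [map_add, map_smul, map_neg, LinearMap.add_apply, LinearMap.smul_apply,
    LinearMap.neg_apply, smul_eq_mul, genForm_vec_covec_self, genForm_covec_vec_self,
    genForm_vec_vec, genForm_covec_covec, genForm_vec_covec_of_ne b hαβ,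
    genForm_vec_covec_of_ne b hβα, genForm_covec_vec_of_ne b hαβ,
    genForm_covec_vec_of_ne b hβα] at g1 g2 g3 g4 g5 g6 g7 g8 g9
  ring_nf at g1 g2 g3 g4 g5 g6 g7 g8 g9
  -- The entry `x` decides the type. If it vanishes, r q = -(1 + p²) makes `r` invertible; otherwise
  -- the equations 2 x q = 0 and x (t - p) = 0 remove the complex part.
  by_cases hx : x = 0
  · left
    subst hx
    have hrq : r * q = -1 - p ^ 2 := by linarith
    have hr : r ≠ 0 := by rintro rfl; nlinarith [sq_nonneg p]
    have hq : q ≠ 0 := by rintro rfl; nlinarith [sq_nonneg p]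
    have ht : t = -p := by
      have : r * (t + p) = 0 := by linarith
      rcases mul_eq_zero.1 this with h | h
      · exact absurd h hr
      · linarith
    have hy : y = 0 := by
      have : r * y = 0 := by linarith
      exact (mul_eq_zero.1 this).resolve_left hr
    have hq' : q = -(1 + p ^ 2) / r := by field_simp; linarith
    refine ⟨p, r, hr, ?_⟩
    rw [hasBlock_complexMatrix_iff]
    refine ⟨?_, ?_, ?_, ?_⟩
    · rw [e0, hy]; module
    · rw [e1, hy, ht, hq']; module
    · rw [e2, hq']; module
    · rw [e3, ht]; module
  · right
    have hq : q = 0 := by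
      have : x * q = 0 := by linarith
      exact (mul_eq_zero.1 this).resolve_left hx
    have ht : t = p := by
      have : x * (t - p) = 0 := by linarith
      rcases mul_eq_zero.1 this with h | h
      · exact absurd h hx
      · linarith
    subst hq ht
    have hxy : t ^ 2 = x * y - 1 := by linarith
    have hr : r = 0 := by
      have hy : y ≠ 0 := by rintro rfl; nlinarith [sq_nonneg t]
      have : r * y = 0 := by linarith
      exact (mul_eq_zero.1 this).resolve_right hy
    subst hr
    refine ⟨t, x, y, hxy, ?_⟩
    rw [hasBlock_noncomplexMatrix_iff]
    refine ⟨?_, ?_, ?_, ?_⟩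
    · rw [e0]; module
    · rw [e1]; module
    · rw [e2]; module
    · rw [e3]; module

end Generalized

/-! ### Pairs of blocks: signs, commutation, positivity -/

section Hermitian

variable {ι N : Type*} [AddCommGroup N] [Module ℝ N] {b : Module.Basis ι ℝ N}
variable {J J' : Module.End ℝ (N × Module.Dual ℝ N)}

/-- A block of complex type of `J` and a block of noncomplex type of `J'`, of the same sign. -/
def IsComplexNoncomplex (b : Module.Basis ι ℝ N) (J J' : Module.End ℝ (N × Module.Dual ℝ N))
    (α β : ι) : Prop :=
  ∃ s c a x y : ℝ, 0 < c * x ∧ a ^ 2 = x * y - 1 ∧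
    HasBlock b J α β (complexMatrix s c) ∧ HasBlock b J' α β (noncomplexMatrix a x y)

/-- The pairing on X_α equals c y, and x y = 1 + a² > 0 gives `x` the sign of `y`. -/
lemma mul_pos_of_complex_of_noncomplex {α β : ι} (hαβ : α ≠ β) {s c a x y : ℝ}
    (h : a ^ 2 = x * y - 1) (hJ : HasBlock b J α β (complexMatrix s c))
    (hJ' : HasBlock b J' α β (noncomplexMatrix a x y))
    (hpos : 0 < genForm N (J (b α, 0)) (J' (b α, 0))) : 0 < c * x := by
  rw [((hasBlock_complexMatrix_iff b).1 hJ).1, ((hasBlock_noncomplexMatrix_iff b).1 hJ').1] at hpos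
  simp only [map_add, map_smul, LinearMap.add_apply, LinearMap.smul_apply,
    smul_eq_mul, genForm_vec_covec_self, genForm_vec_vec, genForm_vec_covec_of_ne b hαβ] at hpos
  have hcy : 0 < c * y := by linarith
  have hxy : 0 < x * y := by nlinarith [sq_nonneg a]
  by_contra hcx
  nlinarith [mul_pos hcy hxy, sq_nonneg y, mul_nonneg (sq_nonneg y) (sub_nonneg.2 (not_lt.1 hcx))]

/-- Equal types contradict positivity on X_α: both images lie in one isotropic plane, spanned by X_α
and X_β for the complex type and by X_α and X_β* for the noncomplex type. -/
lemma isComplexNoncomplex_or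
    (hpos : ∀ v, v ≠ 0 → 0 < genForm N (J v) (J' v)) {α β : ι} (hαβ : α ≠ β)
    (h : (∃ s c, c ≠ 0 ∧ HasBlock b J α β (complexMatrix s c)) ∨
      ∃ a x y, a ^ 2 = x * y - 1 ∧ HasBlock b J α β (noncomplexMatrix a x y))
    (h' : (∃ s c, c ≠ 0 ∧ HasBlock b J' α β (complexMatrix s c)) ∨
      ∃ a x y, a ^ 2 = x * y - 1 ∧ HasBlock b J' α β (noncomplexMatrix a x y)) :
    IsComplexNoncomplex b J J' α β ∨ IsComplexNoncomplex b J' J α β := by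
  have hb : ((b α, 0) : N × Module.Dual ℝ N) ≠ 0 := fun e => b.ne_zero α (congrArg Prod.fst e)
  have hp := hpos _ hb
  rcases h with ⟨s, c, hc, hC⟩ | ⟨a, x, y, hxy, hNC⟩ <;>
    rcases h' with ⟨s', c', hc', hC'⟩ | ⟨a', x', y', hxy', hNC'⟩
  · rw [((hasBlock_complexMatrix_iff b).1 hC).1, ((hasBlock_complexMatrix_iff b).1 hC').1] at hp
    simp [genForm_apply] at hp
  · exact .inl ⟨s, c, a', x', y', mul_pos_of_complex_of_noncomplex hαβ hxy' hC hNC' hp, hxy',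
      hC, hNC'⟩
  · rw [genForm_comm] at hp
    exact .inr ⟨s', c', a, x, y, mul_pos_of_complex_of_noncomplex hαβ hxy hC' hNC hp, hxy,
      hC', hNC⟩
  · rw [((hasBlock_noncomplexMatrix_iff b).1 hNC).1,
      ((hasBlock_noncomplexMatrix_iff b).1 hNC').1] at hp
    simp [genForm_apply, hαβ.symm] at hp

/-- The frame members at `α` suffice: those at `β` are covered when `β` takes the place of `α`. -/
lemma IsComplexNoncomplex.commute {α β : ι} (h : IsComplexNoncomplex b J J' α β) :
    J (J' (b α, 0)) = J' (J (b α, 0)) ∧ J (J' (0, b.coord α)) = J' (J (0, b.coord α)) := by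
  obtain ⟨s, c, a, x, y, -, -, hJ, hJ'⟩ := h
  obtain ⟨h0, h1, h2, h3⟩ := (hasBlock_complexMatrix_iff b).1 hJ
  obtain ⟨k0, k1, k2, k3⟩ := (hasBlock_noncomplexMatrix_iff b).1 hJ'
  constructor
  · simp only [h0, k0, map_add, map_smul, k1, h3]; module
  · simp only [h2, k2, map_add, map_smul, k3, h1]; module

variable (b J J') in
/-- The contribution of the index `γ` to `⟨J v, J' v⟩`. -/
noncomputable def hermitianTerm (v : N × Module.Dual ℝ N) (γ : ι) : ℝ :=
  genForm N (J v) (0, b.coord γ) * genForm N (J' v) (b γ, 0) +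
    genForm N (J v) (b γ, 0) * genForm N (J' v) (0, b.coord γ)

lemma hermitianTerm_comm (v : N × Module.Dual ℝ N) (γ : ι) :
    hermitianTerm b J J' v γ = hermitianTerm b J' J v γ := by
  rw [hermitianTerm, hermitianTerm]; ring

lemma hermitian_form_pos {s c a x y : ℝ} (hcx : 0 < c * x) (h : a ^ 2 = x * y - 1)
    (v₁ v₂ v₃ v₄ : ℝ) {Q : ℝ}
    (hQ : c * Q = y * (c * v₁ - s * v₂) ^ 2 - 2 * a * (c * v₁ - s * v₂) * (c * v₄ + s * v₃) +
      x * (c * v₄ + s * v₃) ^ 2 + (y * v₂ ^ 2 + 2 * a * v₂ * v₃ + x * v₃ ^ 2)) :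
    0 ≤ Q ∧ (Q = 0 → v₁ = 0 ∧ v₃ = 0) := by
  -- Both binary forms in `hQ` have determinant x y - a² = 1; multiplying by `x` completes the
  -- squares. If `Q` vanishes, v₂ and v₁ drop out in turn, then v₃.
  have key : c * x * Q = (x * (c * v₄ + s * v₃) - a * (c * v₁ - s * v₂)) ^ 2 +
      (c * v₁ - s * v₂) ^ 2 + (x * v₃ + a * v₂) ^ 2 + v₂ ^ 2 := by
    linear_combination x * hQ - ((c * v₁ - s * v₂) ^ 2 + v₂ ^ 2) * h
  have hc : c ≠ 0 := left_ne_zero_of_mul hcx.ne'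
  have hx : x ≠ 0 := right_ne_zero_of_mul hcx.ne'
  refine ⟨nonneg_of_mul_nonneg_right (by rw [key]; positivity) hcx, fun h0 => ?_⟩
  rw [h0, mul_zero] at key
  have h1 : v₂ = 0 := by
    apply pow_eq_zero_iff (two_ne_zero) |>.1
    nlinarith [sq_nonneg (x * (c * v₄ + s * v₃) - a * (c * v₁ - s * v₂)),
      sq_nonneg (c * v₁ - s * v₂), sq_nonneg (x * v₃ + a * v₂), sq_nonneg v₂]
  subst h1
  have h2 : c * v₁ = 0 := by
    apply pow_eq_zero_iff (two_ne_zero) |>.1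
    nlinarith [sq_nonneg (x * (c * v₄ + s * v₃) - a * (c * v₁ - s * 0)),
      sq_nonneg (c * v₁), sq_nonneg (x * v₃)]
  have h3 : x * v₃ = 0 := by
    apply pow_eq_zero_iff (two_ne_zero) |>.1
    nlinarith [sq_nonneg (x * (c * v₄ + s * v₃) - a * (c * v₁ - s * 0)),
      sq_nonneg (c * v₁), sq_nonneg (x * v₃)]
  exact ⟨(mul_eq_zero.1 h2).resolve_left hc, (mul_eq_zero.1 h3).resolve_left hx⟩

lemma IsComplexNoncomplex.hermitianTerm_pos (hJ : IsGenComplex J) (hJ' : IsGenComplex J')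
    {α β : ι} (h : IsComplexNoncomplex b J J' α β) (v : N × Module.Dual ℝ N) :
    0 ≤ hermitianTerm b J J' v α + hermitianTerm b J J' v β ∧
    (hermitianTerm b J J' v α + hermitianTerm b J J' v β = 0 →
      genForm N v (0, b.coord α) = 0 ∧ genForm N v (b α, 0) = 0) := by
  obtain ⟨s, c, a, x, y, hcx, hxy, hC, hNC⟩ := h
  obtain ⟨h0, h1, h2, h3⟩ := (hasBlock_complexMatrix_iff b).1 hC
  obtain ⟨k0, k1, k2, k3⟩ := (hasBlock_noncomplexMatrix_iff b).1 hNC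
  have hc : c ≠ 0 := left_ne_zero_of_mul hcx.ne'
  -- The four numbers are the coordinates of `v` along X_α, X_β, X_α*, X_β*. Skewness moves `J` and
  -- `J'` from `v` onto the frame.
  apply hermitian_form_pos hcx hxy (genForm N v (0, b.coord α)) (genForm N v (0, b.coord β))
    (genForm N v (b α, 0)) (genForm N v (b β, 0)) (s := s)
  simp only [hermitianTerm, hJ.skew, hJ'.skew, h0, h1, h2, h3, k0, k1, k2, k3, map_add, map_smul,
    smul_eq_mul]
  field_simp
  ring

variable [Fintype ι]

/-- Blocks of opposite types and the same sign make up a generalized Hermitian structure. -/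
lemma IsGenComplex.hermitian_of_blocks (hJ : IsGenComplex J) (hJ' : IsGenComplex J')
    {σ : ι → ι} (hσ : Function.Involutive σ)
    (h : ∀ α, IsComplexNoncomplex b J J' α (σ α) ∨ IsComplexNoncomplex b J' J α (σ α)) :
    J * J' = J' * J ∧ ∀ v, v ≠ 0 → 0 < genForm N (J v) (J' v) := by
  classical
  constructor
  · have hc : ∀ α, J (J' (b α, 0)) = J' (J (b α, 0)) ∧
        J (J' (0, b.coord α)) = J' (J (0, b.coord α)) := fun α =>
      (h α).elim (fun h => h.commute) fun h => ⟨h.commute.1.symm, h.commute.2.symm⟩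
    have hd : ∀ v, J (J' v) = J' (J v) := by
      intro v
      rw [eq_sum_genForm b v]
      simp only [map_sum, map_add, map_smul, (hc _).1, (hc _).2]
    exact LinearMap.ext hd
  · intro v hv
    have hblock : ∀ γ, 0 ≤ hermitianTerm b J J' v γ + hermitianTerm b J J' v (σ γ) ∧
        (hermitianTerm b J J' v γ + hermitianTerm b J J' v (σ γ) = 0 →
          genForm N v (0, b.coord γ) = 0 ∧ genForm N v (b γ, 0) = 0) := by
      intro γ
      rcases h γ with h | h
      · exact h.hermitianTerm_pos hJ hJ' v
      · rw [hermitianTerm_comm, hermitianTerm_comm v (σ γ)]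
        exact h.hermitianTerm_pos hJ' hJ v
    -- Summing block contributions over all indices counts each block twice, once from each of its
    -- members.
    have hsum : 2 * genForm N (J v) (J' v) =
        ∑ γ, (hermitianTerm b J J' v γ + hermitianTerm b J J' v (σ γ)) := by
      rw [Finset.sum_add_distrib,
        Fintype.sum_bijective σ hσ.bijective (fun γ => hermitianTerm b J J' v (σ γ))
          (hermitianTerm b J J' v) fun _ => rfl, ← two_mul, genForm_eq_sum b]
      rfl
    have hpos : 0 < ∑ γ, (hermitianTerm b J J' v γ + hermitianTerm b J J' v (σ γ)) := by
      refine (Finset.sum_nonneg fun γ _ => (hblock γ).1).lt_of_ne' fun h0 => hv ?_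
      rw [Finset.sum_eq_zero_iff_of_nonneg fun γ _ => (hblock γ).1] at h0
      rw [eq_sum_genForm b v]
      refine Finset.sum_eq_zero fun γ hγ => ?_
      obtain ⟨h1, h2⟩ := (hblock γ).2 (h0 γ hγ)
      rw [h1, h2, zero_smul, zero_smul, add_zero]
    linarith

end Hermitian

/-! ### The sign characters of M -/

section Characters

variable {𝔤 : Type*} [LieRing 𝔤] [LieAlgebra ℝ 𝔤] [FiniteDimensional ℝ 𝔤]

lemma groupK_commute {θ : 𝔤 →ₗ⁅ℝ⁆ 𝔤} {k : 𝔤 ≃ₗ[ℝ] 𝔤} (hk : k ∈ groupK θ) (x : 𝔤) :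
    θ (k x) = k (θ x) := by
  induction hk using Subgroup.closure_induction generalizing x with
  | mem φ h =>
    obtain ⟨⟨Z, hZ, hφ⟩, -⟩ := h
    have h1 : Commute (θ : 𝔤 →ₗ[ℝ] 𝔤) (LieAlgebra.ad ℝ 𝔤 Z) := by
      ext y
      simp [hZ]
    have h2 := (commute_expEnd h1).eq
    rw [← hφ] at h2
    exact LinearMap.congr_fun h2 x
  | one => rfl
  | mul a b _ _ ha hb => rw [LinearEquiv.mul_apply, ha, hb]; rfl
  | inv a _ ha =>
    apply a.injective
    rw [← ha, ← LinearEquiv.mul_apply, ← LinearEquiv.mul_apply]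
    simp

lemma groupK_killingForm {θ : 𝔤 →ₗ⁅ℝ⁆ 𝔤} {k : 𝔤 ≃ₗ[ℝ] 𝔤} (hk : k ∈ groupK θ) (x y : 𝔤) :
    killingForm ℝ 𝔤 (k x) (k y) = killingForm ℝ 𝔤 x y :=
  LieAlgebra.killingForm_of_equiv_apply
    ({ k with map_lie' := fun {x y} => groupK_lie θ hk x y } : 𝔤 ≃ₗ⁅ℝ⁆ 𝔤) x y

variable [LieAlgebra.IsKilling ℝ 𝔤]
variable {A : LieSubalgebra ℝ 𝔤} [A.IsCartanSubalgebra] [LieModule.IsTriangularizable ℝ A 𝔤]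

/-- `M` acts on each root space by a sign. -/
lemma IsCartanInvolution.exists_sign {θ : 𝔤 →ₗ⁅ℝ⁆ 𝔤} (hθ : IsCartanInvolution A θ) :
    ∃ χ : groupM A θ → A.root → ℝ, (∀ m α, χ m α = 1 ∨ χ m α = -1) ∧
      ∀ m α, ∀ x ∈ rootSpace A α.1, adRep A θ m x = χ m α • x := by
  have h : ∀ (m : groupM A θ) (α : A.root), ∃ s : ℝ, (s = 1 ∨ s = -1) ∧
      ∀ x ∈ rootSpace A α.1, adRep A θ m x = s • x := by
    intro m α
    have hα := A.isNonZero_coe_root α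
    obtain ⟨x, hx, hx0⟩ := α.1.exists_ne_zero
    obtain ⟨s, hs⟩ := exists_eq_smul_of_mem_rootSpace hα hx hx0
      (adRep_mem_rootSpace A θ α.1 m hx)
    refine ⟨s, ?_, ?_⟩
    -- Elements of K preserve the Killing form and commute with θ, so κ(x, θ x) ≠ 0 is multiplied by
    -- s² and unchanged.
    · have h1 : killingForm ℝ 𝔤 (adRep A θ m x) (θ (adRep A θ m x)) =
          killingForm ℝ 𝔤 x (θ x) := by
        change killingForm ℝ 𝔤 (((m : groupK θ) : 𝔤 ≃ₗ[ℝ] 𝔤) x)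
          (θ (((m : groupK θ) : 𝔤 ≃ₗ[ℝ] 𝔤) x)) = _
        rw [groupK_commute m.1.2, groupK_killingForm m.1.2]
      rw [hs, map_smul, map_smul, map_smul, LinearMap.smul_apply, smul_eq_mul, smul_eq_mul] at h1
      have h2 := hθ.neg_of_ne_zero x hx0
      have h3 : s * s = 1 := by
        apply mul_right_cancel₀ h2.ne
        linarith
      exact mul_self_eq_one_iff.1 h3
    · intro y hy
      obtain ⟨c, rfl⟩ := exists_eq_smul_of_mem_rootSpace hα hx hx0 hy
      rw [map_smul, hs, smul_comm]
  choose χ h1 h2 using h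
  exact ⟨χ, h1, h2⟩

lemma WeylBasis.X_ne_zero (W : WeylBasis A) (α : A.root) : W.X α ≠ 0 := by
  intro h
  have := W.killing α
  rw [h] at this
  simp at this

/-- Root spaces are lines on which M acts by scalars: an intertwiner equates the scalars, and if
they agree every linear isomorphism intertwines. -/
lemma mEquiv_iff {θ : 𝔤 →ₗ⁅ℝ⁆ 𝔤} (W : WeylBasis A) {χ : groupM A θ → A.root → ℝ}
    (hχ : ∀ m α, ∀ x ∈ rootSpace A α.1, adRep A θ m x = χ m α • x) {α β : A.root} :
    MEquiv A θ α β ↔ ∀ m, χ m α = χ m β := by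
  have hrep : ∀ (m : groupM A θ) (α : A.root) (x : (rootSpace A α.1).toSubmodule),
      rootRep A θ α m x = χ m α • x := fun m α x => Subtype.ext (hχ m α x x.2)
  constructor
  · rintro ⟨e⟩ m
    set x : (rootSpace A α.1).toSubmodule := ⟨W.X α, W.mem α⟩
    have hx : x ≠ 0 := fun h => W.X_ne_zero α (congrArg Subtype.val h)
    have h1 : e.toLinearEquiv (rootRep A θ α m x) = rootRep A θ β m (e.toLinearEquiv x) :=
      LinearMap.congr_fun (e.toIntertwiningMap.isIntertwining' m) x
    rw [hrep, hrep, map_smul] at h1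
    exact smul_left_injective ℝ (e.toLinearEquiv.map_ne_zero_iff.2 hx) h1
  · intro h
    have h1 : ∀ α : A.root, Module.finrank ℝ (rootSpace A α.1).toSubmodule = 1 := fun α =>
      finrank_rootSpace_eq_one α.1 (A.isNonZero_coe_root α)
    let e : (rootSpace A α.1).toSubmodule ≃ₗ[ℝ] (rootSpace A β.1).toSubmodule :=
      LinearEquiv.ofFinrankEq _ _ ((h1 α).trans (h1 β).symm)
    refine ⟨Representation.Equiv.mk e fun m => ?_⟩
    ext x
    simp [hrep, h]

end Characters

/-! ### The Weyl basis of 𝔫⁻ and M-equivariance -/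

section Basis

variable {𝔤 : Type*} [LieRing 𝔤] [LieAlgebra ℝ 𝔤] [FiniteDimensional ℝ 𝔤]
  [LieAlgebra.IsKilling ℝ 𝔤]
variable {A : LieSubalgebra ℝ 𝔤} [A.IsCartanSubalgebra] [LieModule.IsTriangularizable ℝ A 𝔤]
variable {B : (LieAlgebra.IsKilling.rootSystem A).Base}

lemma WeylBasis.covec_vec_self (W : WeylBasis A) (α : NegRoot B) : W.covec α (W.vec α) = 1 := by
  change killingForm ℝ 𝔤 (W.X (negRoot A α.1)) (W.X α.1) = 1
  rw [LieModule.traceForm_comm]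
  exact W.killing α.1

lemma WeylBasis.covec_vec_of_ne (W : WeylBasis A) {α β : NegRoot B} (h : α ≠ β) :
    W.covec α (W.vec β) = 0 := by
  change killingForm ℝ 𝔤 (W.X (negRoot A α.1)) (W.X β.1) = 0
  refine killingForm_apply_eq_zero_of_mem_rootSpace_of_add_ne_zero ℝ 𝔤 A
    (W.mem (negRoot A α.1)) (W.mem β.1) fun h0 => h ?_
  have h1 : (β.1.1 : A → ℝ) = α.1.1 := by
    have : -(α.1.1 : A → ℝ) + β.1.1 = 0 := h0
    exact (neg_add_eq_zero.1 this).symm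
  exact Subtype.ext (Subtype.ext (DFunLike.coe_injective h1.symm))

lemma WeylBasis.linearIndependent_vec (W : WeylBasis A) :
    LinearIndependent ℝ (W.vec (B := B)) := by
  classical
  rw [Fintype.linearIndependent_iff]
  intro g hg i
  have := congrArg (W.covec i) hg
  rw [map_sum, Finset.sum_eq_single i] at this
  · simpa [W.covec_vec_self] using this
  · intro j _ hj
    rw [map_smul, W.covec_vec_of_ne hj.symm, smul_zero]
  · simp

lemma WeylBasis.top_le_span_vec (W : WeylBasis A) :
    ⊤ ≤ Submodule.span ℝ (Set.range (W.vec (B := B))) := by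
  rintro ⟨x, hx⟩ -
  suffices h : nMinus B ≤ (Submodule.span ℝ (Set.range (W.vec (B := B)))).map
      (nMinus B).subtype by
    obtain ⟨y, hy, rfl⟩ := h hx
    exact hy
  refine iSup_le fun α x hx => ?_
  obtain ⟨c, rfl⟩ := exists_eq_smul_of_mem_rootSpace (A.isNonZero_coe_root α.1) (W.mem α.1)
    (W.X_ne_zero α.1) hx
  exact ⟨c • W.vec α, Submodule.smul_mem _ _ (Submodule.subset_span ⟨α, rfl⟩), rfl⟩

/-- The negative part of a Weyl basis as a basis of `𝔫⁻`. -/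
noncomputable def WeylBasis.basis (W : WeylBasis A)
    (B : (LieAlgebra.IsKilling.rootSystem A).Base) : Module.Basis (NegRoot B) ℝ (nMinus B) :=
  Module.Basis.mk W.linearIndependent_vec W.top_le_span_vec

@[simp] lemma WeylBasis.basis_apply (W : WeylBasis A) (α : NegRoot B) :
    W.basis B α = W.vec α := Module.Basis.mk_apply _ _ α

@[simp] lemma WeylBasis.basis_coord (W : WeylBasis A) (α : NegRoot B) :
    (W.basis B).coord α = W.covec α := by
  classical
  apply (W.basis B).ext
  intro β
  rw [Module.Basis.coord_apply, Module.Basis.repr_self, WeylBasis.basis_apply]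
  by_cases h : α = β
  · subst h; rw [W.covec_vec_self, Finsupp.single_eq_same]
  · rw [W.covec_vec_of_ne h, Finsupp.single_eq_of_ne h]

lemma WeylBasis.genFrame_basis (W : WeylBasis A) (α β : NegRoot B) :
    genFrame (W.basis B) α β = W.frame α β := by
  simp [genFrame, WeylBasis.frame]

lemma hasRestriction_iff {θ : 𝔤 →ₗ⁅ℝ⁆ 𝔤} (W : WeylBasis A) (𝒥 : InvGenAlmostComplex θ B)
    (α β : NegRoot B) (P : Matrix (Fin 4) (Fin 4) ℝ) :
    HasRestriction W 𝒥 α β P ↔ HasBlock (W.basis B) (𝒥.J 1) α β P := by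
  rw [HasRestriction, HasBlock, W.genFrame_basis]

lemma InvGenAlmostComplex.J_eq {θ : 𝔤 →ₗ⁅ℝ⁆ 𝔤} (𝒥 : InvGenAlmostComplex θ B) (k : groupK θ) :
    𝒥.J k = 𝒥.J 1 := by
  simpa using 𝒥.invariant k 1

lemma genForm_eq_two_mul_pairing (v w : GenTangent B) :
    genForm (nMinus B) v w = 2 * pairing v w := by
  rw [genForm_apply, pairing]; ring

lemma InvGenAlmostComplex.isGenComplex {θ : 𝔤 →ₗ⁅ℝ⁆ 𝔤} (𝒥 : InvGenAlmostComplex θ B) :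
    IsGenComplex (𝒥.J 1) where
  apply_apply v := LinearMap.congr_fun (𝒥.sq 1) v
  orthogonal v w := by
    rw [genForm_eq_two_mul_pairing, 𝒥.orthogonal, genForm_eq_two_mul_pairing]

lemma isGenAlmostHermitian_iff {θ : 𝔤 →ₗ⁅ℝ⁆ 𝔤} (𝒥 𝒥' : InvGenAlmostComplex θ B) :
    IsGenAlmostHermitian 𝒥 𝒥' ↔ 𝒥.J 1 * 𝒥'.J 1 = 𝒥'.J 1 * 𝒥.J 1 ∧
      ∀ v, v ≠ 0 → 0 < genForm (nMinus B) (𝒥.J 1 v) (𝒥'.J 1 v) := by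
  simp only [IsGenAlmostHermitian, 𝒥.J_eq, 𝒥'.J_eq, genForm_eq_two_mul_pairing, forall_const,
    mul_pos_iff_of_pos_left (zero_lt_two' ℝ)]

section Equivariance

variable {θ : 𝔤 →ₗ⁅ℝ⁆ 𝔤} (W : WeylBasis A) {χ : groupM A θ → A.root → ℝ}

lemma isotropyRep_vec (hχ : ∀ m α, ∀ x ∈ rootSpace A α.1, adRep A θ m x = χ m α • x)
    (m : groupM A θ) (α : NegRoot B) :
    isotropyRep θ B m (W.vec α) = χ m α.1 • W.vec α :=
  Subtype.ext (hχ m α.1 _ (W.mem α.1))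

lemma genIsotropyRep_vec (hχ : ∀ m α, ∀ x ∈ rootSpace A α.1, adRep A θ m x = χ m α • x)
    (m : groupM A θ) (α : NegRoot B) :
    genIsotropyRep θ B m (W.vec α, 0) = χ m α.1 • (W.vec α, 0) := by
  apply Prod.ext
  · exact isotropyRep_vec W hχ m α
  · simp [genIsotropyRep]

lemma genForm_genIsotropyRep (m : groupM A θ) (v w : GenTangent B) :
    genForm (nMinus B) (genIsotropyRep θ B m v) (genIsotropyRep θ B m w) =
      genForm (nMinus B) v w := by
  have h : ∀ x, isotropyRep θ B m⁻¹ (isotropyRep θ B m x) = x := fun x => by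
    rw [← Module.End.mul_apply, ← map_mul]; simp
  simp [genForm_apply, genIsotropyRep, Representation.dual_apply, Module.Dual.transpose_apply, h]

/-- A sign is its own inverse, so the dual line carries the same character. This is what allows
noncomplex blocks to mix vectors and covectors. -/
lemma genIsotropyRep_covec (h1 : ∀ m α, χ m α = 1 ∨ χ m α = -1)
    (hχ : ∀ m α, ∀ x ∈ rootSpace A α.1, adRep A θ m x = χ m α • x)
    (m : groupM A θ) (α : NegRoot B) :
    genIsotropyRep θ B m (0, W.covec α) = χ m α.1 • (0, W.covec α) := by
  have hinv : ∀ γ : NegRoot B, isotropyRep θ B m⁻¹ (W.vec γ) = χ m γ.1 • W.vec γ := by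
    intro γ
    have h2 : isotropyRep θ B m⁻¹ (isotropyRep θ B m (W.vec γ)) = W.vec γ := by
      rw [← Module.End.mul_apply, ← map_mul]; simp
    rw [isotropyRep_vec W hχ, map_smul] at h2
    conv_rhs => rw [← h2]
    rw [smul_smul]
    rcases h1 m γ.1 with h | h <;> simp [h]
  apply Prod.ext
  · simp [genIsotropyRep]
  · apply (W.basis B).ext
    intro γ
    change W.covec α (isotropyRep θ B m⁻¹ (W.basis B γ)) = χ m α.1 • W.covec α (W.basis B γ)
    rw [W.basis_apply, hinv, map_smul]
    by_cases h : α = γ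
    · rw [h]
    · rw [W.covec_vec_of_ne h, smul_zero, smul_zero]

/-- K-invariance makes `J` constant on K, and equivariance under right translation by M then becomes
commutation. -/
lemma InvGenAlmostComplex.commute (𝒥 : InvGenAlmostComplex θ B) (m : groupM A θ)
    (v : GenTangent B) :
    𝒥.J 1 (genIsotropyRep θ B m v) = genIsotropyRep θ B m (𝒥.J 1 v) := by
  have h := 𝒥.equivariant 1 m
  rw [𝒥.J_eq] at h
  have h2 := congrArg (fun T => genIsotropyRep θ B m * T) h
  simp only [← mul_assoc, ← map_mul, mul_inv_cancel, map_one, one_mul] at h2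
  exact (LinearMap.congr_fun h2 v).symm

/-- Vectors on which some element of `M` acts by different signs are not related by an invariant
structure. -/
lemma InvGenAlmostComplex.genForm_eq_zero (𝒥 : InvGenAlmostComplex θ B) {m : groupM A θ}
    {v w : GenTangent B} {s t : ℝ} (hs : s = 1 ∨ s = -1) (ht : t = 1 ∨ t = -1) (hst : s ≠ t)
    (hv : genIsotropyRep θ B m v = s • v) (hw : genIsotropyRep θ B m w = t • w) :
    genForm (nMinus B) (𝒥.J 1 v) w = 0 := by
  have h := genForm_genIsotropyRep m (𝒥.J 1 v) w
  rw [← 𝒥.commute, hv, hw, map_smul, map_smul, map_smul, LinearMap.smul_apply, smul_eq_mul,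
    smul_eq_mul] at h
  rcases hs with rfl | rfl <;> rcases ht with rfl | rfl
  · exact absurd rfl hst
  · linarith
  · linarith
  · exact absurd rfl hst

end Equivariance

end Basis

/-! ### Integral coordinates for roots and coroots -/

section Lattice

variable {n : ℕ}

/-- In the set of lattice vectors `S`, `c` is a coroot of the long root `g`. -/
def IsLongCoroot (S : Set (Fin n → ℤ)) (g c : Fin n → ℤ) : Prop :=
  g ∈ S ∧ c ⬝ᵥ g = 2 ∧ (∀ p ∈ S, p - (c ⬝ᵥ p) • g ∈ S) ∧
    ∀ p ∈ S, p ≠ g → p ≠ -g → c ⬝ᵥ p = 0 ∨ c ⬝ᵥ p = 1 ∨ c ⬝ᵥ p = -1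

/-- The Cartan integers with long roots separate modulo `2` the roots up to sign, apart from pairs
of roots. -/
def IsSeparated (S : Set (Fin n → ℤ)) : Prop :=
  ∀ p ∈ S, ∃ p', ∀ q ∈ S,
    (∀ g c, IsLongCoroot S g c → (Even (c ⬝ᵥ p) ↔ Even (c ⬝ᵥ q))) →
      q = p ∨ q = -p ∨ q = p' ∨ q = -p'

variable {V : Type*} [AddCommGroup V]

/-- The vector with integral coordinates `p` with respect to the family `l`. -/
def latticeVec (l : Fin n → V) (p : Fin n → ℤ) : V := ∑ i, p i • l i

lemma latticeVec_neg (l : Fin n → V) (p : Fin n → ℤ) : latticeVec l (-p) = -latticeVec l p := by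
  simp [latticeVec]

lemma latticeVec_add (l : Fin n → V) (p q : Fin n → ℤ) :
    latticeVec l (p + q) = latticeVec l p + latticeVec l q := by
  simp [latticeVec, add_smul, Finset.sum_add_distrib]

lemma latticeVec_single (l : Fin n → V) (i : Fin n) (a : ℤ) :
    latticeVec l (Pi.single i a) = a • l i := by
  rw [latticeVec, Finset.sum_eq_single i]
  · rw [Pi.single_eq_same]
  · intro k _ hk
    rw [Pi.single_eq_of_ne hk, zero_smul]
  · simp

lemma latticeVec_sub_smul [Module ℝ V] (l : Fin n → V) (p g : Fin n → ℤ) (k : ℤ) :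
    latticeVec l (p - k • g) = latticeVec l p - (k : ℝ) • latticeVec l g := by
  rw [Int.cast_smul_eq_zsmul]
  simp [latticeVec, sub_smul, Finset.smul_sum, mul_smul]

lemma map_latticeVec [Module ℝ V] (f : V →ₗ[ℝ] ℝ) (l : Fin n → V) (p : Fin n → ℤ) :
    f (latticeVec l p) = ∑ i, (p i : ℝ) * f (l i) := by
  simp [latticeVec]

end Lattice

/-! ### From integral models to the root system -/

section Roots

variable {𝔤 : Type*} [LieRing 𝔤] [LieAlgebra ℝ 𝔤] [FiniteDimensional ℝ 𝔤]
  [LieAlgebra.IsKilling ℝ 𝔤]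
variable {A : LieSubalgebra ℝ 𝔤} [A.IsCartanSubalgebra] [LieModule.IsTriangularizable ℝ A 𝔤]

lemma mem_rootFunctionals (α : A.root) : α.1.toLinear ∈ rootFunctionals A := ⟨α, rfl⟩

/-- The coroot is determined by the reflection preserving the roots. -/
lemma apply_coroot_eq_of_mapsTo (γ : A.root) {f : Module.Dual ℝ (Module.Dual ℝ A)}
    (h2 : f γ.1.toLinear = 2)
    (hf : Set.MapsTo (Module.preReflection γ.1.toLinear f) (rootFunctionals A)
      (rootFunctionals A)) (φ : Module.Dual ℝ A) : φ (coroot γ.1) = f φ := by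
  have h := Module.Dual.eq_of_preReflection_mapsTo (x := γ.1.toLinear) (Φ := rootFunctionals A)
    (Set.finite_range _) (RootPairing.IsRootSystem.span_root_eq_top (P := rootSystem A))
    (f := f) (g := Module.Dual.eval ℝ A (coroot γ.1)) h2 hf (root_apply_coroot_self γ) ?_
  · rw [h]; rfl
  · rintro _ ⟨α, rfl⟩
    exact ⟨(rootSystem A).reflectionPerm γ α, by
      rw [RootPairing.root_reflectionPerm, RootPairing.reflection_apply]; rfl⟩

variable {n : ℕ} (l : Module.Basis (Fin n) ℝ (Module.Dual ℝ A))

/-- The functional with coordinates `c` defines a reflection preserving the roots, and such a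
functional is unique. Cartan integers thus become integral dot products. -/
lemma latticeVec_apply_coroot {S : Set (Fin n → ℤ)}
    (hS : rootFunctionals A = latticeVec l '' S) {g c : Fin n → ℤ}
    (h : IsLongCoroot S g c) {γ : A.root} (hγ : γ.1.toLinear = latticeVec l g)
    (p : Fin n → ℤ) : latticeVec l p (coroot γ.1) = (c ⬝ᵥ p : ℤ) := by
  obtain ⟨-, h2, hr, -⟩ := h
  let f : Module.Dual ℝ (Module.Dual ℝ A) := l.constr ℝ fun i => (c i : ℝ)
  have hf : ∀ p, f (latticeVec l p) = (c ⬝ᵥ p : ℤ) := by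
    intro p
    rw [map_latticeVec, dotProduct]
    push_cast
    refine Finset.sum_congr rfl fun i _ => ?_
    rw [mul_comm]
    simp only [f, Module.Basis.constr_basis]
  rw [apply_coroot_eq_of_mapsTo γ (f := f), hf]
  · rw [hγ, hf, h2]; norm_num
  · rw [hS]
    rintro _ ⟨q, hq, rfl⟩
    refine ⟨q - (c ⬝ᵥ q) • g, hr q hq, ?_⟩
    rw [Module.preReflection_apply, hf, latticeVec_sub_smul, hγ]

lemma isLong_of_isLongCoroot {S : Set (Fin n → ℤ)}
    (hS : rootFunctionals A = latticeVec l '' S) {g c : Fin n → ℤ}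
    (h : IsLongCoroot S g c) {γ : A.root} (hγ : γ.1.toLinear = latticeVec l g) :
    IsLong γ := by
  intro α h1 h2
  have hα := mem_rootFunctionals α
  rw [hS] at hα
  obtain ⟨p, hp, hpα⟩ := hα
  have key := latticeVec_apply_coroot l hS h hγ p
  rw [hpα, Weight.toLinear_apply] at key
  have hinj : ∀ {a b : A.root}, a.1.toLinear = b.1.toLinear → a = b := fun {a b} hab =>
    (rootSystem A).root.injective hab
  have hp1 : p ≠ g := by
    rintro rfl
    exact h1 (hinj (hpα.symm.trans hγ.symm))
  have hp2 : p ≠ -g := by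
    rintro rfl
    refine h2 (hinj ?_)
    rw [← hpα, latticeVec_neg, ← hγ]
    rfl
  rcases h.2.2.2 p hp hp1 hp2 with e | e | e <;> rw [key, e] <;> simp

lemma even_iff_of_cos_eq {a c : ℤ} (h : Real.cos (Real.pi * a) = Real.cos (Real.pi * c)) :
    Even a ↔ Even c := by
  rw [mul_comm, Real.cos_int_mul_pi, mul_comm, Real.cos_int_mul_pi] at h
  rcases Int.even_or_odd a with ha | ha <;> rcases Int.even_or_odd c with hc | hc
  · simp [ha, hc]
  · rw [ha.neg_one_zpow, hc.neg_one_zpow] at h; norm_num at h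
  · rw [ha.neg_one_zpow, hc.neg_one_zpow] at h; norm_num at h
  · simp [← Int.not_odd_iff_even, ha, hc]

variable (A) in
/-- The signs of the half turns in long roots separate the roots up to sign, apart from pairs of
roots. -/
def SeparatesRoots : Prop :=
  ∀ α : A.root, ∃ φ : Module.Dual ℝ A, ∀ δ : A.root,
    (∀ γ : A.root, IsLong γ →
      Real.cos (Real.pi * α.1 (coroot γ.1)) = Real.cos (Real.pi * δ.1 (coroot γ.1))) →
    δ.1.toLinear = α.1.toLinear ∨ δ.1.toLinear = -α.1.toLinear ∨ δ.1.toLinear = φ ∨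
      δ.1.toLinear = -φ

lemma IsSeparated.separatesRoots {S : Set (Fin n → ℤ)} (h : IsSeparated S)
    (hS : rootFunctionals A = latticeVec l '' S) : SeparatesRoots A := by
  intro α
  have hα := mem_rootFunctionals α
  rw [hS] at hα
  obtain ⟨p, hp, hpα⟩ := hα
  obtain ⟨p', hp'⟩ := h p hp
  refine ⟨latticeVec l p', fun δ hδ => ?_⟩
  have hδ' := mem_rootFunctionals δ
  rw [hS] at hδ'
  obtain ⟨q, hq, hqδ⟩ := hδ'
  rw [← hpα, ← hqδ, ← latticeVec_neg, ← latticeVec_neg]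
  have := hp' q hq fun g c hgc => by
    have hg : latticeVec l g ∈ rootFunctionals A := hS ▸ ⟨g, hgc.1, rfl⟩
    obtain ⟨γ, hγ⟩ := hg
    have e := hδ γ (isLong_of_isLongCoroot l hS hgc hγ)
    rw [← Weight.toLinear_apply, ← Weight.toLinear_apply, ← hpα, ← hqδ,
      latticeVec_apply_coroot l hS hgc hγ, latticeVec_apply_coroot l hS hgc hγ] at e
    exact even_iff_of_cos_eq e
  rcases this with e | e | e | e <;> simp [e]

end Roots

/-! ### Parity computations in types B₂, G₂ and D -/

section Models

/-- The roots of type `B₂`. -/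
def rootsB2 : Finset (Fin 2 → ℤ) :=
  {![1, 1], ![1, -1], ![-1, 1], ![-1, -1], ![1, 0], ![-1, 0], ![0, 1], ![0, -1]}

/-- The roots of type `G₂`. -/
def rootsG2 : Finset (Fin 2 → ℤ) :=
  {![1, 0], ![0, 1], ![1, 1], ![1, 2], ![1, 3], ![2, 3],
    ![-1, 0], ![0, -1], ![-1, -1], ![-1, -2], ![-1, -3], ![-2, -3]}

/-- One long root is enough: the parity of the coordinate sum tells the two long roots (up to sign)
from the two short ones. -/
lemma isSeparated_rootsB2 : IsSeparated (rootsB2 : Set (Fin 2 → ℤ)) := by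
  have h1 : IsLongCoroot (rootsB2 : Set (Fin 2 → ℤ)) ![1, 1] ![1, 1] := by
    simp only [IsLongCoroot, Finset.mem_coe]; decide
  have h : ∀ p ∈ rootsB2, ∃ p' ∈ rootsB2, ∀ q ∈ rootsB2,
      (Even (![1, 1] ⬝ᵥ p) ↔ Even (![1, 1] ⬝ᵥ q)) → q = p ∨ q = -p ∨ q = p' ∨ q = -p' := by
    decide
  intro p hp
  obtain ⟨p', -, hp'⟩ := h p hp
  exact ⟨p', fun q hq hpq => hp' q hq (hpq _ _ h1)⟩

/-- The two long coroots read off both coordinates modulo 2. The six roots up to sign fall into the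
three nonzero residues, two in each. -/
lemma isSeparated_rootsG2 : IsSeparated (rootsG2 : Set (Fin 2 → ℤ)) := by
  have h1 : IsLongCoroot (rootsG2 : Set (Fin 2 → ℤ)) ![1, 0] ![2, -1] := by
    simp only [IsLongCoroot, Finset.mem_coe]; decide
  have h2 : IsLongCoroot (rootsG2 : Set (Fin 2 → ℤ)) ![2, 3] ![1, 0] := by
    simp only [IsLongCoroot, Finset.mem_coe]; decide
  have h : ∀ p ∈ rootsG2, ∃ p' ∈ rootsG2, ∀ q ∈ rootsG2,
      (Even (![2, -1] ⬝ᵥ p) ↔ Even (![2, -1] ⬝ᵥ q)) →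
      (Even (![1, 0] ⬝ᵥ p) ↔ Even (![1, 0] ⬝ᵥ q)) →
      q = p ∨ q = -p ∨ q = p' ∨ q = -p' := by
    decide +kernel
  intro p hp
  obtain ⟨p', -, hp'⟩ := h p hp
  exact ⟨p', fun q hq hpq => hp' q hq (hpq _ _ h1) (hpq _ _ h2)⟩

variable {n : ℕ}

/-- The roots of type `D_n`. -/
def rootsD (n : ℕ) : Set (Fin n → ℤ) := {p | p ⬝ᵥ p = 2}

lemma dotProduct_self_nonneg_int (p : Fin n → ℤ) : 0 ≤ p ⬝ᵥ p :=
  Finset.sum_nonneg fun _ _ => mul_self_nonneg _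

/-- All roots have square norm 2, so each is its own coroot and is long: the norms 4 ± 2⟨g, p⟩ of p
± g are positive, forcing |⟨g, p⟩| ≤ 1. -/
lemma isLongCoroot_rootsD {g : Fin n → ℤ} (hg : g ∈ rootsD n) :
    IsLongCoroot (rootsD n) g g := by
  have hg' : g ⬝ᵥ g = 2 := hg
  refine ⟨hg, hg, fun p hp => ?_, fun p hp h1 h2 => ?_⟩
  · have hp' : p ⬝ᵥ p = 2 := hp
    change _ = _
    simp only [sub_dotProduct, dotProduct_sub, smul_dotProduct, dotProduct_smul, smul_eq_mul,
      dotProduct_comm p g, hp', hg']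
    ring
  · have hp' : p ⬝ᵥ p = 2 := hp
    have e1 : (p - g) ⬝ᵥ (p - g) = 4 - 2 * (g ⬝ᵥ p) := by
      simp only [sub_dotProduct, dotProduct_sub, dotProduct_comm p g, hp', hg']; ring
    have e2 : (p + g) ⬝ᵥ (p + g) = 4 + 2 * (g ⬝ᵥ p) := by
      simp only [add_dotProduct, dotProduct_add, dotProduct_comm p g, hp', hg']; ring
    have f1 : (p - g) ⬝ᵥ (p - g) ≠ 0 := by
      rw [Ne, dotProduct_self_eq_zero, sub_eq_zero]; exact h1
    have f2 : (p + g) ⬝ᵥ (p + g) ≠ 0 := by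
      rw [Ne, dotProduct_self_eq_zero, add_eq_zero_iff_eq_neg]; exact h2
    have := dotProduct_self_nonneg_int (p - g)
    have := dotProduct_self_nonneg_int (p + g)
    omega

lemma mem_rootsD_iff {p : Fin n → ℤ} : p ∈ rootsD n ↔ ∃ (i j : Fin n) (s t : ℤˣ), i ≠ j ∧
    p = Pi.single i (s : ℤ) + Pi.single j (t : ℤ) := by
  have hunit : ∀ a : ℤ, a ≠ 0 → a * a ≤ 2 → ∃ s : ℤˣ, (s : ℤ) = a := by
    intro a h0 h2
    have h1 : a ≤ 1 := by nlinarith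
    have h3 : -1 ≤ a := by nlinarith
    rcases (by omega : a = 1 ∨ a = -1) with rfl | rfl
    · exact ⟨1, rfl⟩
    · exact ⟨-1, rfl⟩
  have hsq : ∀ s : ℤˣ, (s : ℤ) * s = 1 := fun s => by rw [← Units.val_mul, Int.units_mul_self]; rfl
  constructor
  · intro hp
    have hp' : ∑ x, p x * p x = 2 := hp
    obtain ⟨i, hi⟩ : ∃ i, p i ≠ 0 := by
      by_contra! h
      simp [h] at hp'
    rw [← Finset.add_sum_erase _ _ (Finset.mem_univ i)] at hp'
    have hr : 0 ≤ ∑ x ∈ Finset.univ.erase i, p x * p x :=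
      Finset.sum_nonneg fun _ _ => mul_self_nonneg _
    obtain ⟨s, hs⟩ := hunit (p i) hi (by linarith)
    rw [← hs, hsq] at hp'
    obtain ⟨j, hj, hj0⟩ : ∃ j ∈ Finset.univ.erase i, p j ≠ 0 := by
      by_contra! h
      rw [Finset.sum_eq_zero fun x hx => by rw [h x hx, mul_zero]] at hp'
      norm_num at hp'
    rw [← Finset.add_sum_erase _ _ hj] at hp'
    have hr' : 0 ≤ ∑ x ∈ (Finset.univ.erase i).erase j, p x * p x :=
      Finset.sum_nonneg fun _ _ => mul_self_nonneg _
    obtain ⟨t, ht⟩ := hunit (p j) hj0 (by linarith)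
    rw [← ht, hsq] at hp'
    have h0 : ∑ x ∈ (Finset.univ.erase i).erase j, p x * p x = 0 := by linarith
    rw [Finset.sum_eq_zero_iff_of_nonneg fun _ _ => mul_self_nonneg _] at h0
    have hij : i ≠ j := fun e => by simp [e] at hj
    refine ⟨i, j, s, t, hij, ?_⟩
    funext x
    by_cases hxi : x = i
    · subst hxi; simp [hs, hij]
    by_cases hxj : x = j
    · subst hxj; simp [ht, hxi]
    have := h0 x (by simp [hxi, hxj])
    simp [hxi, hxj, mul_self_eq_zero.1 this]
  · rintro ⟨i, j, s, t, hij, rfl⟩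
    change _ = _
    simp [hij, hij.symm, hsq]

/-- Pairing with e_x + e_y gives modulo 2 the number of indices shared with the support of a root.
These parities recover the support, leaving only the signs free. For n = 4 a support and its
complement are indistinguishable. -/
lemma isSeparated_rootsD (hn : n = 3 ∨ 5 ≤ n) : IsSeparated (rootsD n) := by
  intro p hp
  obtain ⟨i, j, s, t, hij, rfl⟩ := mem_rootsD_iff.1 hp
  refine ⟨Pi.single i (s : ℤ) - Pi.single j (t : ℤ), fun q hq h => ?_⟩
  obtain ⟨k, m, u, v, hkm, rfl⟩ := mem_rootsD_iff.1 hq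
  have hodd : ∀ s : ℤˣ, ¬ Even (s : ℤ) := fun s => by
    rcases Int.units_eq_one_or s with rfl | rfl <;> decide
  have hpar : ∀ x y : Fin n, x ≠ y →
      (Even ((Pi.single i (s : ℤ) + Pi.single j (t : ℤ) : Fin n → ℤ) x +
        (Pi.single i (s : ℤ) + Pi.single j (t : ℤ) : Fin n → ℤ) y) ↔
      Even ((Pi.single k (u : ℤ) + Pi.single m (v : ℤ) : Fin n → ℤ) x +
        (Pi.single k (u : ℤ) + Pi.single m (v : ℤ) : Fin n → ℤ) y)) := by
    intro x y hxy
    have hg : (Pi.single x 1 + Pi.single y 1 : Fin n → ℤ) ∈ rootsD n :=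
      mem_rootsD_iff.2 ⟨x, y, 1, 1, hxy, rfl⟩
    have := h _ _ (isLongCoroot_rootsD hg)
    simpa only [add_dotProduct, single_dotProduct, one_mul] using this
  have hcase : (k = i ∧ m = j) ∨ (k = j ∧ m = i) := by
    have h1 := hpar i j hij
    by_cases hki : k = i
    · subst hki
      by_cases hmj : m = j
      · exact .inl ⟨rfl, hmj⟩
      · simp [hij, hij.symm, hkm, Ne.symm hmj, Int.even_add, hodd] at h1
    by_cases hkj : k = j
    · subst hkj
      by_cases hmi : m = i
      · exact .inr ⟨rfl, hmi⟩
      · simp [hij, hij.symm, hkm, Ne.symm hmi, Int.even_add, hodd] at h1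
    by_cases hmi : m = i
    · subst hmi
      simp [hij, hij.symm, Ne.symm hki, Ne.symm hkj, Int.even_add, hodd] at h1
    by_cases hmj : m = j
    · subst hmj
      simp [hij, hij.symm, Ne.symm hki, Ne.symm hkj, Int.even_add, hodd] at h1
    exfalso
    -- Disjoint supports occupy four indices, impossible for n = 3. For n ≥ 5 a fifth index `x`
    -- exists, and e_i + e_x pairs oddly with one root and evenly with the other.
    have hcard : ({i, j, k, m} : Finset (Fin n)).card = 4 := by
      rw [Finset.card_insert_of_notMem, Finset.card_insert_of_notMem, Finset.card_pair hkm]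
      · simp [Ne.symm hkj, Ne.symm hmj]
      · simp [hij, Ne.symm hki, Ne.symm hmi]
    have hle := Finset.card_le_univ ({i, j, k, m} : Finset (Fin n))
    rw [hcard, Fintype.card_fin] at hle
    obtain ⟨x, hx⟩ : ∃ x, x ∉ ({i, j, k, m} : Finset (Fin n)) := by
      by_contra! hall
      have := Finset.eq_univ_iff_forall.2 hall
      rw [this, Finset.card_univ, Fintype.card_fin] at hcard
      omega
    simp only [Finset.mem_insert, Finset.mem_singleton, not_or] at hx
    have h2 := hpar i x (Ne.symm hx.1)
    simp [hij, hx.1, hx.2.1, hx.2.2.1, hx.2.2.2, Ne.symm hki, Ne.symm hmi, hodd] at h2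
  have hsign : ∀ a c : ℤˣ, (a : ℤ) = c ∨ (a : ℤ) = -c := by decide
  rcases hcase with ⟨rfl, rfl⟩ | ⟨rfl, rfl⟩
  · rcases hsign u s with h1 | h1 <;> rcases hsign v t with h2 | h2 <;>
      simp only [h1, h2, Pi.single_neg]
    · simp
    · exact .inr (.inr (.inl (by abel)))
    · exact .inr (.inr (.inr (by abel)))
    · exact .inr (.inl (by abel))
  · rcases hsign v s with h1 | h1 <;> rcases hsign u t with h2 | h2 <;>
      simp only [h1, h2, Pi.single_neg]
    · exact .inl (by abel)
    · exact .inr (.inr (.inl (by abel)))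
    · exact .inr (.inr (.inr (by abel)))
    · exact .inr (.inl (by abel))

variable {V : Type*} [AddCommGroup V]

lemma image_rootsB2 (l : Fin 2 → V) :
    latticeVec l '' (rootsB2 : Set (Fin 2 → ℤ)) =
      {φ | (∃ s t : ℤˣ, φ = s • l 0 + t • l 1) ∨ ∃ (s : ℤˣ) (i : Fin 2), φ = s • l i} := by
  have h1 : ∀ s t : ℤˣ, ![(s : ℤ), (t : ℤ)] ∈ rootsB2 := by decide
  have h2 : ∀ (s : ℤˣ) (i : Fin 2), (Pi.single i (s : ℤ) : Fin 2 → ℤ) ∈ rootsB2 := by decide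
  have h3 : ∀ q ∈ rootsB2, (∃ s t : ℤˣ, q = ![(s : ℤ), (t : ℤ)]) ∨
      ∃ (s : ℤˣ) (i : Fin 2), q = Pi.single i (s : ℤ) := by decide
  have h4 : ∀ s t : ℤˣ, latticeVec l ![(s : ℤ), (t : ℤ)] = s • l 0 + t • l 1 := fun s t => by
    simp [latticeVec, Units.smul_def]
  ext φ
  constructor
  · rintro ⟨q, hq, rfl⟩
    rcases h3 q hq with ⟨s, t, rfl⟩ | ⟨s, i, rfl⟩
    · exact .inl ⟨s, t, h4 s t⟩
    · exact .inr ⟨s, i, latticeVec_single l i s⟩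
  · rintro (⟨s, t, rfl⟩ | ⟨s, i, rfl⟩)
    · exact ⟨_, h1 s t, h4 s t⟩
    · exact ⟨_, h2 s i, latticeVec_single l i s⟩

lemma image_rootsG2 (l : Fin 2 → V) :
    latticeVec l '' (rootsG2 : Set (Fin 2 → ℤ)) =
      {φ | ∃ (s : ℤˣ) (p : ℤ × ℤ),
        p ∈ ({(1, 0), (0, 1), (1, 1), (1, 2), (1, 3), (2, 3)} : Set (ℤ × ℤ)) ∧
        φ = s • (p.1 • l 0 + p.2 • l 1)} := by
  let P : Finset (ℤ × ℤ) := {(1, 0), (0, 1), (1, 1), (1, 2), (1, 3), (2, 3)}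
  have hP : ∀ p : ℤ × ℤ,
      p ∈ ({(1, 0), (0, 1), (1, 1), (1, 2), (1, 3), (2, 3)} : Set (ℤ × ℤ)) ↔ p ∈ P := by
    simp [P]
  have h1 : ∀ p ∈ P, ∀ s : ℤˣ, ![(s : ℤ) * p.1, (s : ℤ) * p.2] ∈ rootsG2 := by decide
  have h2 : ∀ q ∈ rootsG2, ∃ s : ℤˣ, ∃ p ∈ P, q = ![(s : ℤ) * p.1, (s : ℤ) * p.2] := by decide
  have h3 : ∀ (s : ℤˣ) (p : ℤ × ℤ),
      latticeVec l ![(s : ℤ) * p.1, (s : ℤ) * p.2] = s • (p.1 • l 0 + p.2 • l 1) := fun s p => by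
    simp [latticeVec, Units.smul_def, smul_add, mul_smul]
  ext φ
  constructor
  · rintro ⟨q, hq, rfl⟩
    obtain ⟨s, p, hp, rfl⟩ := h2 q hq
    exact ⟨s, p, (hP p).2 hp, h3 s p⟩
  · rintro ⟨s, p, hp, rfl⟩
    exact ⟨_, h1 p ((hP p).1 hp) s, h3 s p⟩

lemma image_rootsD (l : Fin n → V) :
    latticeVec l '' rootsD n =
      {φ | ∃ (i j : Fin n) (s t : ℤˣ), i < j ∧ φ = s • l i + t • l j} := by
  have h : ∀ (i j : Fin n) (s t : ℤˣ),
      latticeVec l (Pi.single i (s : ℤ) + Pi.single j (t : ℤ)) = s • l i + t • l j := by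
    intro i j s t
    rw [latticeVec_add, latticeVec_single, latticeVec_single]
    rfl
  ext φ
  constructor
  · rintro ⟨_, hp, rfl⟩
    obtain ⟨i, j, s, t, hij, rfl⟩ := mem_rootsD_iff.1 hp
    rw [h]
    rcases lt_or_gt_of_ne hij with h | h
    · exact ⟨i, j, s, t, h, rfl⟩
    · exact ⟨j, i, t, s, h, add_comm _ _⟩
  · rintro ⟨i, j, s, t, hij, rfl⟩
    exact ⟨_, mem_rootsD_iff.2 ⟨i, j, s, t, hij.ne, rfl⟩, h i j s t⟩

end Models

/-! ### The special types -/

section Types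

variable {𝔤 : Type*} [LieRing 𝔤] [LieAlgebra ℝ 𝔤] [FiniteDimensional ℝ 𝔤]
  [LieAlgebra.IsKilling ℝ 𝔤]
variable {A : LieSubalgebra ℝ 𝔤} [A.IsCartanSubalgebra] [LieModule.IsTriangularizable ℝ A 𝔤]

lemma IsTypeB2.separatesRoots (h : IsTypeB2 A) : SeparatesRoots A := by
  obtain ⟨l, hl⟩ := h
  exact isSeparated_rootsB2.separatesRoots l (hl.trans (image_rootsB2 l).symm)

lemma IsTypeG2.separatesRoots (h : IsTypeG2 A) : SeparatesRoots A := by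
  obtain ⟨l, hl⟩ := h
  exact isSeparated_rootsG2.separatesRoots l (hl.trans (image_rootsG2 l).symm)

lemma IsTypeD.separatesRoots {n : ℕ} (hn : n = 3 ∨ 5 ≤ n) (h : IsTypeD A n) :
    SeparatesRoots A := by
  obtain ⟨l, hl⟩ := h
  exact (isSeparated_rootsD hn).separatesRoots l (hl.trans (image_rootsD l).symm)

/-- Type `A₃` is type `D₃`. -/
lemma IsTypeA3.isTypeD (h : IsTypeA3 A) : IsTypeD A 3 := by
  obtain ⟨l, hli, hl⟩ := h
  set d : Fin 3 → Module.Dual ℝ A := fun i => l i.castSucc - l i.succ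
  have hd0 : d 0 = l 0 - l 1 := rfl
  have hd1 : d 1 = l 1 - l 2 := rfl
  have hd2 : d 2 = l 2 - l 3 := rfl
  have hspan : ⊤ ≤ Submodule.span ℝ (Set.range d) := by
    rw [← RootPairing.IsRootSystem.span_root_eq_top (P := rootSystem A), Submodule.span_le]
    change rootFunctionals A ⊆ _
    rw [hl]
    have hmem : ∀ i : Fin 4, l i - l 3 ∈ Submodule.span ℝ (Set.range d) := by
      have hd : ∀ i, d i ∈ Submodule.span ℝ (Set.range d) := fun i =>
        Submodule.subset_span ⟨i, rfl⟩
      intro i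
      fin_cases i
      · have : l 0 - l 3 = d 0 + d 1 + d 2 := by rw [hd0, hd1, hd2]; abel
        exact this ▸ Submodule.add_mem _ (Submodule.add_mem _ (hd 0) (hd 1)) (hd 2)
      · have : l 1 - l 3 = d 1 + d 2 := by rw [hd1, hd2]; abel
        exact this ▸ Submodule.add_mem _ (hd 1) (hd 2)
      · exact hd 2
      · simp
    rintro _ ⟨i, j, -, rfl⟩
    have := Submodule.sub_mem _ (hmem i) (hmem j)
    rwa [sub_sub_sub_cancel_right] at this
  let bd := Module.Basis.mk hli hspan
  have hrank : Module.finrank ℝ (Module.Dual ℝ A) = 3 := by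
    rw [Module.finrank_eq_card_basis bd, Fintype.card_fin]
  -- Up to sign, these are the weights of the exterior square of the standard representation of 𝔰𝔩₄,
  -- normalized so that only differences of the `l i` enter; they realize 𝔰𝔩₄ as 𝔰𝔬(3,3).
  let e : Fin 3 → Module.Dual ℝ A :=
    ![(2⁻¹ : ℝ) • (l 0 + l 1 - l 2 - l 3), (2⁻¹ : ℝ) • (l 0 + l 2 - l 1 - l 3),
      (2⁻¹ : ℝ) • (l 0 + l 3 - l 1 - l 2)]
  have he0 : e 0 = (2⁻¹ : ℝ) • (l 0 + l 1 - l 2 - l 3) := rfl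
  have he1 : e 1 = (2⁻¹ : ℝ) • (l 0 + l 2 - l 1 - l 3) := rfl
  have he2 : e 2 = (2⁻¹ : ℝ) • (l 0 + l 3 - l 1 - l 2) := rfl
  have hespan : ⊤ ≤ Submodule.span ℝ (Set.range e) := by
    refine hspan.trans (Submodule.span_le.2 ?_)
    have he : ∀ i, e i ∈ Submodule.span ℝ (Set.range e) := fun i =>
      Submodule.subset_span ⟨i, rfl⟩
    rintro _ ⟨i, rfl⟩
    fin_cases i
    · have : d 0 = e 1 + e 2 := by rw [hd0, he1, he2]; module
      exact this ▸ Submodule.add_mem _ (he 1) (he 2)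
    · have : d 1 = e 0 - e 1 := by rw [hd1, he0, he1]; module
      exact this ▸ Submodule.sub_mem _ (he 0) (he 1)
    · have : d 2 = e 1 - e 2 := by rw [hd2, he1, he2]; module
      exact this ▸ Submodule.sub_mem _ (he 1) (he 2)
  let be := basisOfTopLeSpanOfCardEqFinrank e hespan (by rw [hrank, Fintype.card_fin])
  have hbe : ∀ i, be i = e i := fun i => by
    rw [coe_basisOfTopLeSpanOfCardEqFinrank]
  refine ⟨be, ?_⟩
  rw [hl]
  simp only [hbe]
  ext φ
  constructor
  · rintro ⟨i, j, hij, rfl⟩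
    fin_cases i <;> fin_cases j <;> simp at hij
    · exact ⟨1, 2, 1, 1, by decide, by simp [he1, he2]; module⟩
    · exact ⟨0, 2, 1, 1, by decide, by simp [he0, he2]; module⟩
    · exact ⟨0, 1, 1, 1, by decide, by simp [he0, he1]; module⟩
    · exact ⟨1, 2, -1, -1, by decide, by simp [he1, he2]; module⟩
    · exact ⟨0, 1, 1, -1, by decide, by simp [he0, he1]; module⟩
    · exact ⟨0, 2, 1, -1, by decide, by simp [he0, he2]; module⟩
    · exact ⟨0, 2, -1, -1, by decide, by simp [he0, he2]; module⟩
    · exact ⟨0, 1, -1, 1, by decide, by simp [he0, he1]; module⟩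
    · exact ⟨1, 2, 1, -1, by decide, by simp [he1, he2]; module⟩
    · exact ⟨0, 1, -1, -1, by decide, by simp [he0, he1]; module⟩
    · exact ⟨0, 2, -1, 1, by decide, by simp [he0, he2]; module⟩
    · exact ⟨1, 2, -1, 1, by decide, by simp [he1, he2]; module⟩
  · rintro ⟨i, j, s, t, hij, rfl⟩
    have hcases : (i = 0 ∧ j = 1) ∨ (i = 0 ∧ j = 2) ∨ (i = 1 ∧ j = 2) := by
      revert i j; decide
    rcases hcases with ⟨rfl, rfl⟩ | ⟨rfl, rfl⟩ | ⟨rfl, rfl⟩ <;>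
      rcases Int.units_eq_one_or s with rfl | rfl <;>
      rcases Int.units_eq_one_or t with rfl | rfl
    · exact ⟨0, 3, by decide, by simp [he0, he1]; module⟩
    · exact ⟨1, 2, by decide, by simp [he0, he1]; module⟩
    · exact ⟨2, 1, by decide, by simp [he0, he1]; module⟩
    · exact ⟨3, 0, by decide, by simp [he0, he1]; module⟩
    · exact ⟨0, 2, by decide, by simp [he0, he2]; module⟩
    · exact ⟨1, 3, by decide, by simp [he0, he2]; module⟩
    · exact ⟨3, 1, by decide, by simp [he0, he2]; module⟩
    · exact ⟨2, 0, by decide, by simp [he0, he2]; module⟩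
    · exact ⟨0, 1, by decide, by simp [he1, he2]; module⟩
    · exact ⟨2, 3, by decide, by simp [he1, he2]; module⟩
    · exact ⟨3, 2, by decide, by simp [he1, he2]; module⟩
    · exact ⟨1, 0, by decide, by simp [he1, he2]; module⟩

lemma IsSpecialType.separatesRoots (h : IsSpecialType A) : SeparatesRoots A := by
  rcases h with h | h | h | ⟨n, hn, h⟩
  · exact h.isTypeD.separatesRoots (.inl rfl)
  · exact h.separatesRoots
  · exact h.separatesRoots
  · exact h.separatesRoots (.inr hn)

end Types

/-! ### M-classes of negative roots and the blocks on them -/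

section Classes

variable {𝔤 : Type*} [LieRing 𝔤] [LieAlgebra ℝ 𝔤] [FiniteDimensional ℝ 𝔤]
  [LieAlgebra.IsKilling ℝ 𝔤]
variable {A : LieSubalgebra ℝ 𝔤} [A.IsCartanSubalgebra] [LieModule.IsTriangularizable ℝ A 𝔤]
variable {B : (LieAlgebra.IsKilling.rootSystem A).Base} {θ : 𝔤 →ₗ⁅ℝ⁆ 𝔤}
variable (W : WeylBasis A) {χ : groupM A θ → A.root → ℝ}

lemma NegRoot.eq_of_toLinear_eq {α β : NegRoot B} (h : α.1.1.toLinear = β.1.1.toLinear) : α = β :=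
  Subtype.ext ((rootSystem A).root.injective h)

lemma NegRoot.toLinear_ne_neg (α β : NegRoot B) : β.1.1.toLinear ≠ -α.1.1.toLinear := by
  intro h
  let _ := (rootSystem A).indexNeg
  have h1 : β.1 = -α.1 := by
    apply (rootSystem A).root.injective
    change (rootSystem A).root β.1 = (rootSystem A).root ((rootSystem A).reflectionPerm α.1 α.1)
    rw [RootPairing.root_reflectionPerm, RootPairing.reflection_apply_self]
    exact h
  exact (RootPairing.Base.IsPos.or_neg B α.1).elim α.2 (h1 ▸ β.2)

/-- At most two negative roots have the same character of `M`. -/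
lemma IsCartanInvolution.exists_class_subset (hθ : IsCartanInvolution A θ) (hA : SeparatesRoots A)
    (hχ : ∀ m α, ∀ x ∈ rootSpace A α.1, adRep A θ m x = χ m α • x) (α : NegRoot B) :
    ∃ β : NegRoot B, ∀ γ : NegRoot B, (∀ m, χ m α.1 = χ m γ.1) → γ = α ∨ γ = β := by
  obtain ⟨φ, hφ⟩ := hA α.1
  have key : ∀ γ : NegRoot B, (∀ m, χ m α.1 = χ m γ.1) →
      γ = α ∨ γ.1.1.toLinear = φ ∨ γ.1.1.toLinear = -φ := by
    intro γ hγ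
    have := hφ γ.1 fun δ hδ => by
      obtain ⟨m, hm⟩ := hθ.exists_groupM_of_isLong hδ
      have h : ∀ β : A.root, χ m β = Real.cos (Real.pi * β.1 (coroot δ.1)) := by
        intro β
        obtain ⟨x, hx, hx0⟩ := β.1.exists_ne_zero
        exact smul_left_injective ℝ hx0 ((hχ m β x hx).symm.trans (hm β.1 x hx))
      rw [← h, ← h, hγ]
    rcases this with h | h | h
    · exact .inl (NegRoot.eq_of_toLinear_eq h)
    · exact absurd h (NegRoot.toLinear_ne_neg α γ)
    · exact .inr h
  -- `φ` is only a functional. At most one of ±φ is a negative root; if neither is, β = α serves as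
  -- a default.
  by_cases hβ : ∃ β : NegRoot B, β.1.1.toLinear = φ ∨ β.1.1.toLinear = -φ
  · obtain ⟨β, hβ⟩ := hβ
    refine ⟨β, fun γ hγ => (key γ hγ).imp_right fun h => ?_⟩
    by_cases e : γ.1.1.toLinear = β.1.1.toLinear
    · exact NegRoot.eq_of_toLinear_eq e
    · refine absurd ?_ (NegRoot.toLinear_ne_neg β γ)
      rcases h with h | h <;> rcases hβ with hβ | hβ <;> rw [h, hβ] at e ⊢ <;> simp at e ⊢
  · exact ⟨α, fun γ hγ => (key γ hγ).imp_right fun h => absurd ⟨γ, h⟩ hβ⟩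

lemma InvGenAlmostComplex.entries_eq_zero (𝒥 : InvGenAlmostComplex θ B)
    (h1 : ∀ m α, χ m α = 1 ∨ χ m α = -1)
    (hχ : ∀ m α, ∀ x ∈ rootSpace A α.1, adRep A θ m x = χ m α • x) {γ δ : NegRoot B}
    (h : ¬ ∀ m, χ m δ.1 = χ m γ.1) :
    genForm _ (𝒥.J 1 (W.basis B δ, 0)) (0, (W.basis B).coord γ) = 0 ∧
    genForm _ (𝒥.J 1 (W.basis B δ, 0)) (W.basis B γ, 0) = 0 ∧
    genForm _ (𝒥.J 1 (0, (W.basis B).coord δ)) (0, (W.basis B).coord γ) = 0 ∧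
    genForm _ (𝒥.J 1 (0, (W.basis B).coord δ)) (W.basis B γ, 0) = 0 := by
  obtain ⟨m, hm⟩ := not_forall.1 h
  simp only [W.basis_apply, W.basis_coord]
  have hv := genIsotropyRep_vec (B := B) W hχ m
  have hc := genIsotropyRep_covec (B := B) W h1 hχ m
  exact ⟨𝒥.genForm_eq_zero (h1 m _) (h1 m _) hm (hv δ) (hc γ),
    𝒥.genForm_eq_zero (h1 m _) (h1 m _) hm (hv δ) (hv γ),
    𝒥.genForm_eq_zero (h1 m _) (h1 m _) hm (hc δ) (hc γ),
    𝒥.genForm_eq_zero (h1 m _) (h1 m _) hm (hc δ) (hv γ)⟩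

/-- In the presence of an invariant generalized almost complex structure the `M`-classes have two
elements. -/
lemma InvGenAlmostComplex.exists_class_eq (𝒥 : InvGenAlmostComplex θ B) (W : WeylBasis A)
    (hθ : IsCartanInvolution A θ) (hA : SeparatesRoots A) (h1 : ∀ m α, χ m α = 1 ∨ χ m α = -1)
    (hχ : ∀ m α, ∀ x ∈ rootSpace A α.1, adRep A θ m x = χ m α • x) (α : NegRoot B) :
    ∃ β : NegRoot B, β ≠ α ∧ ∀ γ : NegRoot B, (∀ m, χ m α.1 = χ m γ.1) ↔ γ = α ∨ γ = β := by
  classical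
  obtain ⟨β, hβ⟩ := hθ.exists_class_subset hA hχ α
  -- Otherwise the class is {α}, and J X_α would stay in the sum of one line and its dual.
  have h : β ≠ α ∧ ∀ m, χ m α.1 = χ m β.1 := by
    by_contra hcon
    refine 𝒥.isGenComplex.not_preserves_line (b := W.basis B) α fun γ hγ => ?_
    have := 𝒥.entries_eq_zero W h1 hχ (γ := γ) (δ := α) fun hc => by
      rcases hβ γ hc with rfl | rfl
      · exact hγ rfl
      · exact hcon ⟨hγ, hc⟩
    exact ⟨this.1, this.2.1⟩
  refine ⟨β, h.1, fun γ => ⟨hβ γ, ?_⟩⟩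
  rintro (rfl | rfl)
  · exact fun _ => rfl
  · exact h.2

lemma InvGenAlmostComplex.complex_or_noncomplex (𝒥 : InvGenAlmostComplex θ B)
    (h1 : ∀ m α, χ m α = 1 ∨ χ m α = -1)
    (hχ : ∀ m α, ∀ x ∈ rootSpace A α.1, adRep A θ m x = χ m α • x) {α β : NegRoot B}
    (hβ : β ≠ α) (h : ∀ γ : NegRoot B, (∀ m, χ m α.1 = χ m γ.1) ↔ γ = α ∨ γ = β) :
    (∃ s c, c ≠ 0 ∧ HasBlock (W.basis B) (𝒥.J 1) α β (complexMatrix s c)) ∨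
    ∃ a x y, a ^ 2 = x * y - 1 ∧ HasBlock (W.basis B) (𝒥.J 1) α β (noncomplexMatrix a x y) := by
  classical
  refine 𝒥.isGenComplex.complex_or_noncomplex hβ.symm fun δ hδ γ hγα hγβ => ?_
  refine 𝒥.entries_eq_zero W h1 hχ fun hc => ?_
  have := (h γ).1 fun m => ((h δ).2 hδ m).trans (hc m)
  exact this.elim hγα hγβ

lemma isComplexNoncomplex_iff (𝒥 𝒥' : InvGenAlmostComplex θ B) (α β : NegRoot B) :
    IsComplexNoncomplex (W.basis B) (𝒥.J 1) (𝒥'.J 1) α β ↔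
      (IsComplexPos W 𝒥 α β ∧ IsNoncomplexPos W 𝒥' α β) ∨
      (IsComplexNeg W 𝒥 α β ∧ IsNoncomplexNeg W 𝒥' α β) := by
  simp only [IsComplexPos, IsComplexNeg, IsNoncomplexPos, IsNoncomplexNeg, hasRestriction_iff]
  constructor
  · rintro ⟨s, c, a, x, y, hcx, hxy, hC, hN⟩
    rcases pos_and_pos_or_neg_and_neg_of_mul_pos hcx with ⟨hc, hx⟩ | ⟨hc, hx⟩
    · exact .inl ⟨⟨s, c, hc, hC⟩, a, x, y, hxy, hx, hN⟩
    · exact .inr ⟨⟨s, c, hc, hC⟩, a, x, y, hxy, hx, hN⟩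
  · rintro (⟨⟨s, c, hc, hC⟩, a, x, y, hxy, hx, hN⟩ | ⟨⟨s, c, hc, hC⟩, a, x, y, hxy, hx, hN⟩)
    · exact ⟨s, c, a, x, y, mul_pos hc hx, hxy, hC, hN⟩
    · exact ⟨s, c, a, x, y, mul_pos_of_neg_of_neg hc hx, hxy, hC, hN⟩

lemma isComplexNoncomplex_or_iff (𝒥 𝒥' : InvGenAlmostComplex θ B) (α β : NegRoot B) :
    IsComplexNoncomplex (W.basis B) (𝒥.J 1) (𝒥'.J 1) α β ∨
      IsComplexNoncomplex (W.basis B) (𝒥'.J 1) (𝒥.J 1) α β ↔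
      (IsComplexPos W 𝒥 α β ∧ IsNoncomplexPos W 𝒥' α β) ∨
       (IsNoncomplexPos W 𝒥 α β ∧ IsComplexPos W 𝒥' α β) ∨
       (IsComplexNeg W 𝒥 α β ∧ IsNoncomplexNeg W 𝒥' α β) ∨
       (IsNoncomplexNeg W 𝒥 α β ∧ IsComplexNeg W 𝒥' α β) := by
  rw [isComplexNoncomplex_iff, isComplexNoncomplex_iff]
  tauto

end Classes

end RealFlag
theorem proposition5 {𝔤 : Type*} [LieRing 𝔤] [LieAlgebra ℝ 𝔤] [FiniteDimensional ℝ 𝔤]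
    [LieAlgebra.IsKilling ℝ 𝔤]
    (A : LieSubalgebra ℝ 𝔤) [A.IsCartanSubalgebra] [LieModule.IsTriangularizable ℝ A 𝔤]
    (hA : IsSpecialType A)
    (θ : 𝔤 →ₗ⁅ℝ⁆ 𝔤) (hθ : IsCartanInvolution A θ)
    (B : (LieAlgebra.IsKilling.rootSystem A).Base) (W : WeylBasis A)
    (𝒥 𝒥' : InvGenAlmostComplex θ B) :
    IsGenAlmostHermitian 𝒥 𝒥' ↔
      ∀ α : NegRoot B, ∃ β : NegRoot B, β ≠ α ∧
        {γ : NegRoot B | MEquiv A θ α.1 γ.1} = {α, β} ∧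
        ((IsComplexPos W 𝒥 α β ∧ IsNoncomplexPos W 𝒥' α β) ∨
         (IsNoncomplexPos W 𝒥 α β ∧ IsComplexPos W 𝒥' α β) ∨
         (IsComplexNeg W 𝒥 α β ∧ IsNoncomplexNeg W 𝒥' α β) ∨
         (IsNoncomplexNeg W 𝒥 α β ∧ IsComplexNeg W 𝒥' α β)) := by
  classical
  obtain ⟨χ, h1, hχ⟩ := hθ.exists_sign
  simp only [isGenAlmostHermitian_iff, ← isComplexNoncomplex_or_iff, Set.ext_iff,
    Set.mem_insert_iff, Set.mem_singleton_iff, Set.mem_ofPred_eq, mEquiv_iff W hχ]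
  constructor
  · rintro ⟨-, hpos⟩ α
    obtain ⟨β, hβ, h⟩ := 𝒥.exists_class_eq W hθ hA.separatesRoots h1 hχ α
    exact ⟨β, hβ, h, isComplexNoncomplex_or hpos hβ.symm (𝒥.complex_or_noncomplex W h1 hχ hβ h)
      (𝒥'.complex_or_noncomplex W h1 hχ hβ h)⟩
  · intro h
    choose σ hσ hclass hblock using h
    -- `α` lies in the class {σ α, σ (σ α)} of its partner and differs from σ α.
    have hinv : Function.Involutive σ := fun α => by
      have e := (hclass (σ α) α).1 fun m => ((hclass α (σ α)).2 (.inr rfl) m).symm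
      exact (e.resolve_left (hσ α).symm).symm
    exact 𝒥.isGenComplex.hermitian_of_blocks 𝒥'.isGenComplex hinv hblock
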